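/- **Setting.** Let $d\ge 2$ and let $q:\mathbb R^d\to(0,\infty)$ be a radial probability density, with $\nu(dx)=q(x)\,dx$. A function $f$ is *regularly varying* with exponent $\alpha$, written $f\in RV_\alpha$, if it is eventually positive and $f(tR)/f(R)\to t^\alpha$ as $R\to\infty$ for every $t>0$. Suppose that $q$ has *superexponential decay*: $$q(x)=L(|x|)\,e^{-\psi(|x|)}\qquad(x\in\mathbb R^d),$$ where $L\in RV_\alpha$ for some $\alpha\in\mathbb R$, $\psi\in RV_v$ for some $v>1$, $\psi\in C^2([0,\infty);[0,\infty))$, $\psi'$ is eventually monotone, and as $z\to\infty$: $\psi'(z)>0$ eventually, $\psi(z)\to\infty$ and $(1/\psi')'(z)\to0$. Let $\psi^\leftarrow$ be any function that is a two-sided inverse of $\psi$ near infinity: $\psi^\leftarrow(\psi(z))=z$ for all large $z$ and $\psi(\psi^\leftarrow(y))=y$ for all large $y$. Let $(r_n)$ be a non-increasing sequence with $0<r_n\le1$. Let $\mathcal P_n=\{x_1,\dots,x_N\}$, where $N\sim\mathrm{Po}(n)$ is independent of the i.i.d. points $x_i$ of law $\nu$. Let $G(\mathcal P_n,r_n)$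 be the graph on $\mathcal P_n$ in which two distinct points are adjacent if their distance is less than $r_n$. Put $\mathcal P_n(A)=|\mathcal P_n\cap A|$; "w.h.p." means with probability tending to $1$ as $n\to\infty$; $f=\omega(g)$ means that for every $C>0$, $|f(n)|\ge C|g(n)|$ for all large $n$; $B(0,R)$ is the open ball. **Cells.** For $s,R>0$ let $Q'_j$ ($j\in\mathbb Z^d$) be the half-open cube of side $s$ centred at $z_j=sj$; these cubes partition $\mathbb R^d$. Let $S=\{i: Q'_i\subset B(0,R)\}$. For $i\in S$ let $Q_i=\bigcup_{j\in I(i)}\big(Q'_j\cap B(0,R)\big)$, where $I(i)$ contains every $j$ with $|z_i-z_j|<|z_{i'}-z_j|$ for all $i'\in S\setminus\{i\}$, and contains only indices $j$ with $|z_i-z_j|\le|z_{i'}-z_j|$ for all $i'\in S$; ties may be treated arbitrarily. (If each tied $j$ is put in exactly one $I(i)$ and $S\neq\emptyset$, the $Q_i$ partition $B(0,R)$.) **Theorem (superexponential decay).** 1. If $r_n\,\psi'(\psi^\leftarrow(\log n))=o(\log\log n)$, then w.h.p. $G(\mathcal P_n,r_n)$ is disconnected. 2. If $r_n\,\psi'(\psi^\leftarrow(\log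 n))=\omega(\log\log n)$, then there exist strictly increasing sequences of positive real numbers $(R_n^{(0)})$ and $(R_n^{(1)})$ with $R_n^{(0)}\le R_n^{(1)}$ and $R_n^{(1)}-R_n^{(0)}=o(r_n)$ such that: - w.h.p. $\mathcal P_n\cap B(0,R_n^{(1)})^c=\emptyset$; - if moreover $q$ is bounded away from zero on bounded sets (for example, $q$ continuous), then for every sequence $\gamma_n>0$ with $\gamma_n=o(1)$ and $\gamma_n\,\psi'(\psi^\leftarrow(\log n))=\omega(1)$, and for every choice of the cells $Q_{i,n}$ built with $s=\gamma_nr_n$ and $R=R_n^{(0)}$, w.h.p. for all $i\in S_n(R_n^{(0)})$ (the index set $S$ for these $s,R$), $$(1-\gamma_n)\,n\,\nu(Q_{i,n})\le\mathcal P_n(Q_{i,n})\le(1+\gamma_n)\,n\,\nu(Q_{i,n}).$$ -/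

import Mathlib

open MeasureTheory ProbabilityTheory Filter Topology Asymptotics
open scoped NNReal ENNReal

namespace PoissonGraph

noncomputable section

/-! ### Regular variation, von Mises functions and light tails -/

/-- `f` is regularly varying at infinity with exponent `α`: it is positive (for large arguments) and
`f (t R) / f R → t ^ α` as `R → ∞`, for every `t > 0`. -/
def RegularlyVarying (f : ℝ → ℝ) (α : ℝ) : Prop :=
  (∀ᶠ z in atTop, 0 < f z) ∧
    ∀ t : ℝ, 0 < t → Tendsto (fun R : ℝ => f (t * R) / f R) atTop (𝓝 (t ^ α))

/-- `ψ ∈ C²([0,∞); [0,∞))` is of von Mises type: as `z → ∞`, `ψ' > 0`, `ψ → ∞`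
and `(1 / ψ')' → 0`. -/
structure IsVonMises (ψ : ℝ → ℝ) : Prop where
  contDiffOn : ContDiffOn ℝ 2 ψ (Set.Ici 0)
  nonneg : ∀ z, 0 ≤ z → 0 ≤ ψ z
  deriv_pos : ∀ᶠ z in atTop, 0 < deriv ψ z
  tendsto_atTop : Tendsto ψ atTop atTop
  tendsto_deriv_inv : Tendsto (deriv fun z => 1 / deriv ψ z) atTop (𝓝 0)

/-- `g` is an asymptotic inverse of `ψ`: near infinity, `g` is a two-sided inverse of `ψ`. -/
def IsAsymptoticInverse (ψ g : ℝ → ℝ) : Prop :=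
  (∀ᶠ z in atTop, g (ψ z) = z) ∧ ∀ᶠ y in atTop, ψ (g y) = y

/-- `f` is monotone on some half-line `[M, ∞)` (non-decreasing or non-increasing). -/
def EventuallyMonotone (f : ℝ → ℝ) : Prop :=
  ∃ M : ℝ, MonotoneOn f (Set.Ici M) ∨ AntitoneOn f (Set.Ici M)

/-- `q` is a radial, everywhere positive probability density on `ℝᵈ`. -/
structure IsRadialDensity {d : ℕ} (q : EuclideanSpace ℝ (Fin d) → ℝ) : Prop where
  measurable : Measurable q
  pos : ∀ x, 0 < q x
  lintegral_eq_one : ∫⁻ x, ENNReal.ofReal (q x) = 1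
  radial : ∀ x y, ‖x‖ = ‖y‖ → q x = q y

/-- `q (x) = L (|x|) exp (-ψ (|x|))` has a light tail, with exponent function `ψ`. -/
def HasLightTail {d : ℕ} (q : EuclideanSpace ℝ (Fin d) → ℝ) (ψ : ℝ → ℝ) : Prop :=
  IsVonMises ψ ∧ EventuallyMonotone (deriv ψ) ∧
    ∃ (L : ℝ → ℝ) (α : ℝ), RegularlyVarying L α ∧
      ∀ x, q x = L ‖x‖ * Real.exp (-ψ ‖x‖)

/-- `q` has superexponential decay, with exponent function `ψ`: a light tail with `ψ ∈ RV_v` for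
some `v > 1`. -/
def HasSuperexponentialDecay {d : ℕ} (q : EuclideanSpace ℝ (Fin d) → ℝ) (ψ : ℝ → ℝ) : Prop :=
  HasLightTail q ψ ∧ ∃ v : ℝ, 1 < v ∧ RegularlyVarying ψ v

/-- `q` is bounded away from zero on bounded sets (for instance, `q` is positive and continuous). -/
def LocallyBoundedBelow {d : ℕ} (q : EuclideanSpace ℝ (Fin d) → ℝ) : Prop :=
  ∀ M : ℝ, ∃ c : ℝ, 0 < c ∧ ∀ x, ‖x‖ ≤ M → c ≤ q x

/-- The probability measure `ν` with density `q`. -/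
def densityMeasure {d : ℕ} (q : EuclideanSpace ℝ (Fin d) → ℝ) :
    Measure (EuclideanSpace ℝ (Fin d)) :=
  volume.withDensity fun x => ENNReal.ofReal (q x)

/-! ### The Poisson sample and its random geometric graph -/

/-- `N` has the Poisson law with mean `n`, the `X i` are i.i.d. with law `ν`, and `N` is independent
of the sequence `X`. -/
structure IsPoissonSample {d : ℕ} {Ω : Type*} [MeasurableSpace Ω] (μ : Measure Ω)
    (ν : Measure (EuclideanSpace ℝ (Fin d))) (n : ℕ) (N : Ω → ℕ)
    (X : ℕ → Ω → EuclideanSpace ℝ (Fin d)) : Prop where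
  measurable_card : Measurable N
  measurable_point : ∀ i, Measurable (X i)
  law_card : μ.map N = poissonMeasure (n : ℝ≥0)
  law_point : ∀ i, μ.map (X i) = ν
  iIndep : iIndepFun X μ
  indep : IndepFun N (fun ω i => X i ω) μ

/-- The random point cloud `{X 0, …, X (N - 1)}`. -/
def points {d : ℕ} {Ω : Type*} (N : Ω → ℕ) (X : ℕ → Ω → EuclideanSpace ℝ (Fin d)) (ω : Ω) :
    Set (EuclideanSpace ℝ (Fin d)) :=
  {x | ∃ i < N ω, X i ω = x}

/-- The geometric graph on the point set `P`: two distinct points are adjacent when their distance is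
less than `r`. -/
def geometricGraph {d : ℕ} (P : Set (EuclideanSpace ℝ (Fin d))) (r : ℝ) : SimpleGraph P where
  Adj x y := x ≠ y ∧ dist (x : EuclideanSpace ℝ (Fin d)) y < r
  symm := ⟨fun x y h => ⟨h.1.symm, by simpa [dist_comm] using h.2⟩⟩
  loopless := ⟨fun _ h => h.1 rfl⟩

/-- A graph is disconnected if it has two vertices that no walk joins (so the graph without vertices
is not disconnected). -/
def Disconnected {V : Type*} (G : SimpleGraph V) : Prop := ¬ G.Preconnected

/-- `A n` holds with high probability: the probability of its failure tends to `0`. -/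
def WithHighProbability {Ω : Type*} [MeasurableSpace Ω] (μ : Measure Ω) (A : ℕ → Ω → Prop) : Prop :=
  Tendsto (fun n => μ {ω | ¬ A n ω}) atTop (𝓝 0)

/-! ### The cells -/

/-- The centre `s • j` of the grid cube with index `j`, for the grid of side `s`; the origin is the
centre with index `0`. -/
def gridCentre {d : ℕ} (s : ℝ) (j : Fin d → ℤ) : EuclideanSpace ℝ (Fin d) :=
  WithLp.toLp 2 fun k => s * (j k : ℝ)

/-- The (half-open) grid cube of side `s` with index `j`. -/
def gridCube {d : ℕ} (s : ℝ) (j : Fin d → ℤ) : Set (EuclideanSpace ℝ (Fin d)) :=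
  {x | ∀ k, s * (j k : ℝ) - s / 2 ≤ x k ∧ x k < s * (j k : ℝ) + s / 2}

/-- Indices of the grid cubes that lie inside `B(0, R)`. -/
def innerIndices {d : ℕ} (s R : ℝ) : Set (Fin d → ℤ) :=
  {i | gridCube s i ⊆ Metric.ball 0 R}

/-- Indices `j` whose centre is strictly closer to the centre of `i` than to the centre of any other
inner cube. -/
def strictIndices {d : ℕ} (s R : ℝ) (i : Fin d → ℤ) : Set (Fin d → ℤ) :=
  {j | ∀ i' ∈ innerIndices s R \ {i},
    dist (gridCentre s i) (gridCentre s j) < dist (gridCentre s i') (gridCentre s j)}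

/-- Indices `j` for which `i` is one of the inner cubes with nearest centre. -/
def weakIndices {d : ℕ} (s R : ℝ) (i : Fin d → ℤ) : Set (Fin d → ℤ) :=
  {j | ∀ i' ∈ innerIndices s R,
    dist (gridCentre s i) (gridCentre s j) ≤ dist (gridCentre s i') (gridCentre s j)}

/-- `I` assigns to every inner cube `i` the grid cubes that are merged into its cell: all those whose
centre is strictly closest to that of `i`, and possibly some for which there is a tie. The choice
`I = strictIndices s R` leaves the tied cubes out; assigning each tied cube to exactly one nearest
inner cube makes the cells a partition of `B(0, R)`. -/
def IsCellAssignment {d : ℕ} (s R : ℝ) (I : (Fin d → ℤ) → Set (Fin d → ℤ)) : Prop :=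
  ∀ i ∈ innerIndices s R, strictIndices s R i ⊆ I i ∧ I i ⊆ weakIndices s R i

/-- The cell `⋃_{j ∈ J} (Q'_j ∩ B(0, R))`. -/
def cell {d : ℕ} (s R : ℝ) (J : Set (Fin d → ℤ)) : Set (EuclideanSpace ℝ (Fin d)) :=
  ⋃ j ∈ J, gridCube s j ∩ Metric.ball 0 R

end

end PoissonGraph

/-! Let ψ(z_n) = log n, and for real b let w_n solve ψ(w) + b log w = log n. Everything rests on two
facts about w_n. First, |w_n − z_n| = O(log z_n / ψ'(z_n)), and log z_n is of the order of log log n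
(`IsVonMises.exists_abs_sub_le`, `isTheta_log_log`). Second, the intensity n q near the sphere of
radius w_n is w_n^(α + b + o(1)) (`eventually_forall_abs_log_mul_density_le`). So any power of the
radius can be prescribed as intensity at the price of a shift of order log log n / ψ'(z_n), and the
graph feels this transition zone or not according to the size of r_n relative to it.

If r_n is small, put ρ_n = max(r_n, 1/ψ'(z_n)) = w_n^(−(v−1) + o(1)). The intensity is constant up
to a factor w_n^o(1) in the shell of width of order ρ_n. About w_n^(v + o(1)) disjoint balls of
radius 2ρ_n are centred on the sphere, and b is chosen so that each has mean w_n^(−1/2 + o(1)). The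
events "the inner ball of radius ρ_n is occupied, the rest of the ball is empty" are pairwise
independent with diverging expected number, so by the second moment method two of them occur. They
give two isolated clusters (`IsPoissonSample.measure_not_disconnected_le`).

If r_n is large, both radii are such solutions, so their difference is O(log z_n / ψ'(z_n)) =
o(r_n). For the outer one b is so negative that the mean number of points outside tends to 0. For
the inner one b is so large that the mean of every cell beats the number of cells, and a Chernoff
bound with a union bound suffices (`withHighProbability_cells`).

The analytic input is f(z) = z^(α + o(1)) for regularly varying f, a consequence of the uniform
convergence theorem; it is carried over from ψ to ψ' by monotonicity of ψ', that is, convexity of ψ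
near infinity. -/

namespace PoissonGraph

/-! ### Regular variation -/

/-- Points of an interval at which a sequence of measurable functions that converges to `0` is
uniformly small from some index on fill the interval up to an arbitrarily small measure. -/
lemma exists_volume_forall_ge_abs_le {F : ℕ → ℝ → ℝ}
    (hlim : ∀ u, Tendsto (fun m => F m u) atTop (𝓝 0)) {ε : ℝ} (hε : 0 < ε) :
    ∀ᶠ n in atTop, ENNReal.ofReal (7 / 4) <
      volume (Set.Icc (0 : ℝ) 2 ∩ {u | ∀ m, n ≤ m → |F m u| ≤ ε}) := by
  have hmono : Monotone fun n : ℕ => Set.Icc (0 : ℝ) 2 ∩ {u | ∀ m, n ≤ m → |F m u| ≤ ε} := by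
    intro a b hab u hu
    exact ⟨hu.1, fun m hm => hu.2 m (hab.trans hm)⟩
  have hU : (⋃ n : ℕ, Set.Icc (0 : ℝ) 2 ∩ {u | ∀ m, n ≤ m → |F m u| ≤ ε}) = Set.Icc 0 2 := by
    apply Set.Subset.antisymm
    · exact Set.iUnion_subset fun n => Set.inter_subset_left
    · intro u hu
      have h1 := (hlim u).abs
      rw [abs_zero] at h1
      obtain ⟨n, hn⟩ := eventually_atTop.1 (h1.eventually (ge_mem_nhds hε))
      exact Set.mem_iUnion.2 ⟨n, hu, hn⟩
  have ht := tendsto_measure_iUnion_atTop (μ := volume) hmono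
  rw [hU, Real.volume_Icc] at ht
  refine ht.eventually (lt_mem_nhds ?_)
  exact (ENNReal.ofReal_lt_ofReal_iff (by norm_num)).2 (by norm_num)

/-- Uniform convergence theorem for slowly varying functions, in additive form. -/
lemma eventually_forall_abs_sub_le {h : ℝ → ℝ} (hh : Measurable h)
    (hlim : ∀ u, Tendsto (fun x => h (x + u) - h x) atTop (𝓝 0)) {ε : ℝ} (hε : 0 < ε) :
    ∀ᶠ x in atTop, ∀ u ∈ Set.Icc (0 : ℝ) 1, |h (x + u) - h x| ≤ ε := by
  by_contra hcon
  rw [Filter.not_eventually] at hcon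
  obtain ⟨x, hx, hx'⟩ := exists_seq_forall_of_frequently hcon
  simp only [not_forall, not_le] at hx'
  choose u hu hux using hx'
  have hxu : Tendsto (fun m => x m + u m) atTop atTop :=
    tendsto_atTop_mono (fun m => le_add_of_nonneg_right (hu m).1) hx
  have e1 := exists_volume_forall_ge_abs_le (F := fun m w => h (x m + w) - h (x m))
    (fun w => (hlim w).comp hx) (half_pos hε)
  have e2 := exists_volume_forall_ge_abs_le (F := fun m w => h (x m + u m + w) - h (x m + u m))
    (fun w => (hlim w).comp hxu) (half_pos hε)
  obtain ⟨n, h1, h2⟩ := (e1.and e2).exists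
  set V := Set.Icc (0 : ℝ) 2 ∩ {w | ∀ m, n ≤ m → |h (x m + w) - h (x m)| ≤ ε / 2} with hV
  set W := Set.Icc (0 : ℝ) 2 ∩
    {w | ∀ m, n ≤ m → |h (x m + u m + w) - h (x m + u m)| ≤ ε / 2} with hW
  have hWm : MeasurableSet W := by
    refine measurableSet_Icc.inter ?_
    have : {w | ∀ m, n ≤ m → |h (x m + u m + w) - h (x m + u m)| ≤ ε / 2} =
        ⋂ m, ⋂ (_ : n ≤ m), {w | |h (x m + u m + w) - h (x m + u m)| ≤ ε / 2} := by
      ext; simp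
    rw [this]
    refine MeasurableSet.iInter fun m => MeasurableSet.iInter fun _ => measurableSet_le ?_ measurable_const
    exact ((hh.comp (measurable_const_add _)).sub measurable_const).abs
  -- Both `V` and the translate of `W` by `u n` lie in [0, 3] and have measure above 7/4. Since 7/2
  -- > 3 they meet, and at a common point the two bounds ε/2 contradict the choice of `u n`.
  have hdisj : ¬ Disjoint V ((fun w => u n + w) '' W) := by
    intro hd
    have hm : MeasurableSet ((fun w => u n + w) '' W) :=
      (MeasurableEquiv.addLeft (u n)).measurableSet_image.2 hWm
    have hvol : volume ((fun w => u n + w) '' W) = volume W := by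
      simp [Set.image_add_left, measure_preimage_add]
    have hsub : V ∪ ((fun w => u n + w) '' W) ⊆ Set.Icc 0 3 := by
      rintro y (hy | ⟨w, hw, rfl⟩)
      · exact ⟨hy.1.1, hy.1.2.trans (by norm_num)⟩
      · have h3 := (hu n).1
        have h4 := (hu n).2
        have h5 := hw.1.1
        have h6 := hw.1.2
        exact ⟨by simp only; linarith, by simp only; linarith⟩
    have h3 := measure_mono (μ := volume) hsub
    rw [measure_union hd hm, hvol, Real.volume_Icc] at h3
    have h4 := (ENNReal.add_lt_add h1 h2).trans_le h3
    rw [← ENNReal.ofReal_add (by norm_num) (by norm_num)] at h4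
    have := (ENNReal.ofReal_lt_ofReal_iff (by norm_num)).1 h4
    norm_num at this
  obtain ⟨y, hyV, w, hwW, hy⟩ := Set.not_disjoint_iff.1 hdisj
  have h3 := hyV.2 n le_rfl
  have h4 := hwW.2 n le_rfl
  have h5 := hux n
  simp only at hy
  rw [← hy, ← add_assoc] at h3
  have h6 : h (x n + u n) - h (x n) =
      (h (x n + u n + w) - h (x n)) - (h (x n + u n + w) - h (x n + u n)) := by ring
  rw [h6] at h5
  have h7 := abs_sub (h (x n + u n + w) - h (x n)) (h (x n + u n + w) - h (x n + u n))
  linarith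

/-- Beyond some point `h` changes by at most ε/2 over each unit step; summing the steps leaves a
constant, which the other half of ε absorbs. -/
lemma eventually_abs_le_mul {h : ℝ → ℝ} (hh : Measurable h)
    (hlim : ∀ u, Tendsto (fun x => h (x + u) - h x) atTop (𝓝 0)) {ε : ℝ} (hε : 0 < ε) :
    ∀ᶠ x in atTop, |h x| ≤ ε * x := by
  have e1 := eventually_forall_abs_sub_le hh hlim (half_pos hε)
  obtain ⟨X, hX⟩ := eventually_atTop.1 e1
  have key : ∀ n : ℕ, ∀ y ∈ Set.Icc (X + n) (X + n + 1),
      |h y| ≤ |h X| + (n + 1) * (ε / 2) := by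
    intro n
    induction n with
    | zero =>
      intro y hy
      simp only [Nat.cast_zero, add_zero] at hy
      have h1 := hX X le_rfl (y - X) ⟨by linarith [hy.1], by linarith [hy.2]⟩
      rw [add_sub_cancel] at h1
      have h2 := abs_sub_abs_le_abs_sub (h y) (h X)
      simp only [Nat.cast_zero, zero_add, one_mul]
      linarith
    | succ n ih =>
      intro y hy
      push_cast at hy ⊢
      have h1 := ih (y - 1) ⟨by linarith [hy.1], by linarith [hy.2]⟩
      have h0 : (0 : ℝ) ≤ n := n.cast_nonneg
      have h2 := hX (y - 1) (by linarith [hy.1]) 1 ⟨by norm_num, le_rfl⟩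
      rw [sub_add_cancel] at h2
      have h3 := abs_sub_abs_le_abs_sub (h y) (h (y - 1))
      linarith
  filter_upwards [eventually_ge_atTop X,
    eventually_ge_atTop ((|h X| + ε / 2 - ε / 2 * X) / (ε / 2))] with x hx hx2
  have h1 := key ⌊x - X⌋₊ x ⟨by linarith [Nat.floor_le (sub_nonneg.2 hx)],
    by linarith [Nat.lt_floor_add_one (x - X)]⟩
  rw [div_le_iff₀ (half_pos hε)] at hx2
  have h2 := mul_le_mul_of_nonneg_right (Nat.floor_le (sub_nonneg.2 hx)) (half_pos hε).le
  linarith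

/-- A measurable regularly varying function of exponent `α` is `z ^ (α + o(1))`. -/
lemma RegularlyVarying.eventually_abs_log_sub_le {f : ℝ → ℝ} {α : ℝ} (hf : RegularlyVarying f α)
    (hm : Measurable fun x => Real.log (f (Real.exp x))) {ε : ℝ} (hε : 0 < ε) :
    ∀ᶠ z in atTop, |Real.log (f z) - α * Real.log z| ≤ ε * Real.log z := by
  have h1 : ∀ᶠ x in atTop,
      |Real.log (f (Real.exp x)) - α * x| ≤ ε * x := by
    -- In the variable x = log z, dividing by z ^ α turns regular variation into vanishing
    -- increments of log f(e^x) − α x.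
    refine eventually_abs_le_mul (h := fun x => Real.log (f (Real.exp x)) - α * x)
      (hm.sub (measurable_const.mul measurable_id)) (fun u => ?_) hε
    have h2 := (hf.2 (Real.exp u) (Real.exp_pos u)).comp Real.tendsto_exp_atTop
    have h3 := (Real.continuousAt_log (Real.rpow_pos_of_pos (Real.exp_pos u) α).ne').tendsto.comp h2
    rw [Real.log_rpow (Real.exp_pos u), Real.log_exp] at h3
    have h4 := h3.sub_const (α * u)
    rw [sub_self] at h4
    refine h4.congr' ?_
    have h5 := Real.tendsto_exp_atTop.eventually hf.1
    have h6 := (tendsto_atTop_add_const_right atTop u tendsto_id).eventually h5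
    filter_upwards [h5, h6] with x hx hxu
    simp only [Function.comp, id] at hxu ⊢
    rw [← Real.exp_add, add_comm u x, Real.log_div hxu.ne' hx.ne']
    ring
  filter_upwards [Real.tendsto_log_atTop.eventually h1, eventually_gt_atTop 0] with z hz hz0
  rwa [Real.exp_log hz0] at hz

/-! ### The exponent function -/

lemma IsVonMises.differentiableAt {ψ : ℝ → ℝ} (h : IsVonMises ψ) {z : ℝ} (hz : 0 < z) :
    DifferentiableAt ℝ ψ z :=
  (h.contDiffOn.contDiffAt (Ici_mem_nhds hz)).differentiableAt (by norm_num)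

/-- Regularity of `ψ` is known only on the half-line, and the exponential stays inside it. This
supplies the measurability that `RegularlyVarying` does not contain. -/
lemma IsVonMises.continuous_comp_exp {ψ : ℝ → ℝ} (h : IsVonMises ψ) :
    Continuous fun x => ψ (Real.exp x) :=
  continuous_iff_continuousAt.2 fun x =>
    (h.differentiableAt (Real.exp_pos x)).continuousAt.comp Real.continuous_exp.continuousAt

lemma IsVonMises.exists_deriv_eq {ψ : ℝ → ℝ} (h : IsVonMises ψ) {x y : ℝ} (hx : 0 < x)
    (hxy : x < y) : ∃ c ∈ Set.Ioo x y, ψ y - ψ x = deriv ψ c * (y - x) := by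
  obtain ⟨c, hc, hc'⟩ := exists_deriv_eq_slope ψ hxy
    (fun t ht => (h.differentiableAt (hx.trans_le ht.1)).continuousAt.continuousWithinAt)
    (fun t ht => (h.differentiableAt (hx.trans ht.1)).differentiableWithinAt)
  refine ⟨c, hc, ?_⟩
  rw [hc', div_mul_cancel₀ _ (sub_pos.2 hxy).ne']

lemma IsVonMises.eventually_abs_log_sub_le {ψ : ℝ → ℝ} {v : ℝ} (h : IsVonMises ψ)
    (hv : RegularlyVarying ψ v) {ε : ℝ} (hε : 0 < ε) :
    ∀ᶠ z in atTop, |Real.log (ψ z) - v * Real.log z| ≤ ε * Real.log z :=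
  hv.eventually_abs_log_sub_le (Real.measurable_log.comp h.continuous_comp_exp.measurable) hε

/-- The derivative of a superlinear regularly varying function is eventually non-decreasing if it
is eventually monotone. -/
lemma IsVonMises.exists_monotoneOn_deriv {ψ : ℝ → ℝ} {v : ℝ} (h : IsVonMises ψ)
    (hm : EventuallyMonotone (deriv ψ)) (hv : 1 < v) (hRV : RegularlyVarying ψ v) :
    ∃ M : ℝ, 0 < M ∧ MonotoneOn (deriv ψ) (Set.Ici M) ∧ ∀ z, M ≤ z → 0 < deriv ψ z ∧ 0 < ψ z := by
  obtain ⟨M₁, hM₁⟩ := eventually_atTop.1 (h.deriv_pos.and hRV.1)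
  obtain ⟨M, hM⟩ := hm
  have hM₂ : MonotoneOn (deriv ψ) (Set.Ici M) := by
    refine hM.resolve_right fun ha => ?_
    -- If `ψ'` were non-increasing, the mean slope on [z, 2z] would not exceed that on [z/2, z]. In
    -- the limit, 2^v − 1 ≤ 2(1 − 2^(−v)), which forces 2^v ≤ 2 and contradicts v > 1.
    have h1 : ∀ᶠ z in atTop, ψ (2 * z) / ψ z - 1 ≤ 2 * (1 - ψ (1 / 2 * z) / ψ z) := by
      filter_upwards [eventually_ge_atTop (2 * M), eventually_gt_atTop 0, hRV.1] with z hz hz0 hψ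
      obtain ⟨c, hc, hc'⟩ := h.exists_deriv_eq hz0 (show z < 2 * z by linarith)
      obtain ⟨e, he, he'⟩ := h.exists_deriv_eq (show 0 < 1 / 2 * z by linarith)
        (show 1 / 2 * z < z by linarith)
      have h2 : deriv ψ c ≤ deriv ψ e := ha (show M ≤ e by linarith [he.1])
        (show M ≤ c by linarith [hc.1]) (by linarith [hc.1, he.2])
      have h3 : ψ (2 * z) - ψ z ≤ 2 * (ψ z - ψ (1 / 2 * z)) := by
        rw [hc', he']
        nlinarith
      rw [div_sub_one hψ.ne', one_sub_div hψ.ne', ← mul_div_assoc]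
      gcongr
    have h2 := le_of_tendsto_of_tendsto ((hRV.2 2 (by norm_num)).sub_const 1)
      (((hRV.2 (1 / 2) (by norm_num)).const_sub 1).const_mul 2) h1
    have h3 : (2 : ℝ) < 2 ^ v := by
      simpa using Real.rpow_lt_rpow_of_exponent_lt (show (1 : ℝ) < 2 by norm_num) hv
    rw [Real.div_rpow (by norm_num) (by norm_num), Real.one_rpow] at h2
    have h4 : (0 : ℝ) < 2 ^ v := by linarith
    have h5 : 1 / (2 : ℝ) ^ v * 2 ^ v = 1 := by field_simp
    nlinarith
  refine ⟨max (max M M₁) 1, by positivity, hM₂.mono fun z hz => ?_, fun z hz => hM₁ z ?_⟩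
  · exact (le_max_left _ _).trans ((le_max_left _ _).trans (Set.mem_Ici.1 hz))
  · exact (le_max_right _ _).trans ((le_max_left _ _).trans hz)

/-- The limit 2^v of ψ(2z)/ψ(z) lies strictly between 2 and 2^v + 1. These two constants replace
regular variation in the convexity arguments below. -/
lemma RegularlyVarying.eventually_doubling {ψ : ℝ → ℝ} {v : ℝ} (hRV : RegularlyVarying ψ v)
    (hv : 1 < v) :
    ∀ᶠ z in atTop, 2 * ψ z ≤ ψ (2 * z) ∧ ψ (2 * z) ≤ (2 ^ v + 1) * ψ z := by
  have h3 : (2 : ℝ) < 2 ^ v := by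
    simpa using Real.rpow_lt_rpow_of_exponent_lt (show (1 : ℝ) < 2 by norm_num) hv
  have h4 := hRV.2 2 (by norm_num)
  filter_upwards [h4.eventually (lt_mem_nhds h3), h4.eventually (gt_mem_nhds (lt_add_one _)),
    hRV.1] with z h1 h2 h0
  rw [lt_div_iff₀ h0] at h1
  rw [div_lt_iff₀ h0] at h2
  exact ⟨h1.le, h2.le⟩

section

variable {ψ : ℝ → ℝ} {v : ℝ} (h : IsVonMises ψ) (hm : EventuallyMonotone (deriv ψ)) (hv : 1 < v)
  (hRV : RegularlyVarying ψ v)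
include h hm hv hRV

lemma IsVonMises.eventually_deriv_mono :
    ∀ᶠ M in atTop, ∀ x y, M ≤ x → x ≤ y → deriv ψ x ≤ deriv ψ y := by
  obtain ⟨M, -, hM, -⟩ := h.exists_monotoneOn_deriv hm hv hRV
  filter_upwards [eventually_ge_atTop M] with K hK x y hx hxy
  exact hM (hK.trans hx) (hK.trans (hx.trans hxy)) hxy

/-- Convexity bounds for the increments of `ψ` near infinity. -/
lemma IsVonMises.eventually_forall_sub_le :
    ∀ᶠ M in atTop, ∀ x y, M ≤ x → x ≤ y →
      deriv ψ x * (y - x) ≤ ψ y - ψ x ∧ ψ y - ψ x ≤ deriv ψ y * (y - x) := by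
  filter_upwards [h.eventually_deriv_mono hm hv hRV, eventually_gt_atTop 0] with M hM hM0 x y hx hxy
  rcases hxy.eq_or_lt with rfl | hlt
  · simp
  · obtain ⟨c, hc, hc'⟩ := h.exists_deriv_eq (hM0.trans_le hx) hlt
    rw [hc']
    have h0 : 0 ≤ y - x := sub_nonneg.2 hxy
    exact ⟨mul_le_mul_of_nonneg_right (hM _ _ hx hc.1.le) h0,
      mul_le_mul_of_nonneg_right (hM _ _ (hx.trans hc.1.le) hc.2.le) h0⟩

lemma IsVonMises.eventually_forall_deriv_pos :
    ∀ᶠ M in atTop, ∀ x, M ≤ x → 0 < deriv ψ x ∧ 0 < ψ x := by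
  obtain ⟨M, -, -, hM⟩ := h.exists_monotoneOn_deriv hm hv hRV
  filter_upwards [eventually_ge_atTop M] with K hK x hx
  exact hM x (hK.trans hx)

lemma IsVonMises.eventually_forall_le :
    ∀ᶠ M in atTop, ∀ x y, M ≤ x → x ≤ y → ψ x ≤ ψ y := by
  filter_upwards [h.eventually_forall_sub_le hm hv hRV,
    h.eventually_forall_deriv_pos hm hv hRV] with M h1 h2 x y hx hxy
  have := mul_nonneg (h2 x hx).1.le (sub_nonneg.2 hxy)
  linarith [(h1 x y hx hxy).1]

/-- `z ψ'(z)` and `ψ z` are of the same order. -/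
lemma IsVonMises.eventually_mul_deriv :
    ∀ᶠ z in atTop, z * deriv ψ z ≤ (2 ^ v + 1) * ψ z ∧ ψ z ≤ 2 * (z * deriv ψ z) := by
  obtain ⟨M, ⟨hM1, hM2⟩, hM0⟩ := ((h.eventually_forall_sub_le hm hv hRV).and
    (h.eventually_forall_deriv_pos hm hv hRV)).and (eventually_gt_atTop 0) |>.exists
  filter_upwards [eventually_ge_atTop M, hRV.eventually_doubling hv,
    h.tendsto_atTop.eventually_ge_atTop (2 * ψ M)] with z hz hd hz2
  -- The slope at z is at most the mean slope on [z, 2z] and at least that on [M, z]; `ψ M` is at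
  -- most half of `ψ z`.
  have h1 := (hM1 z (2 * z) hz (by linarith)).1
  have h2 := (hM1 M z le_rfl hz).2
  have h3 := mul_pos hM0 (hM2 z hz).1
  have h4 := (hM2 z hz).2
  constructor
  · nlinarith [hd.2]
  · nlinarith

/-- With C = 2^v + 1, the chain is 2z ψ'(2z) ≤ C ψ(2z) ≤ C² ψ(z) ≤ 2 C² z ψ'(z). -/
lemma IsVonMises.eventually_deriv_two_mul_le :
    ∀ᶠ z in atTop, deriv ψ (2 * z) ≤ (2 ^ v + 1) ^ 2 * deriv ψ z := by
  have e := h.eventually_mul_deriv hm hv hRV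
  have e2 := (tendsto_id.const_mul_atTop (show (0 : ℝ) < 2 by norm_num)).eventually e
  filter_upwards [e, e2, hRV.eventually_doubling hv, eventually_gt_atTop 0] with z h1 h2 h3 h0
  simp only [id] at h2
  have hC : (0 : ℝ) ≤ 2 ^ v + 1 := by positivity
  have h4 : 2 * z * deriv ψ (2 * z) ≤ (2 ^ v + 1) * ((2 ^ v + 1) * (2 * (z * deriv ψ z))) :=
    h2.1.trans (mul_le_mul_of_nonneg_left (h3.2.trans (mul_le_mul_of_nonneg_left h1.2 hC)) hC)
  have h5 : 2 * z * deriv ψ (2 * z) ≤ 2 * z * ((2 ^ v + 1) ^ 2 * deriv ψ z) := by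
    rw [show 2 * z * ((2 ^ v + 1) ^ 2 * deriv ψ z) =
      (2 ^ v + 1) * ((2 ^ v + 1) * (2 * (z * deriv ψ z))) by ring]
    exact h4
  exact le_of_mul_le_mul_left h5 (by linarith)

/-- Since z ψ'(z) equals ψ(z) up to constant factors, ψ' inherits the exponent v − 1: the logarithms
of the constants are o(log z). -/
lemma IsVonMises.eventually_abs_log_deriv_sub_le {ε : ℝ} (hε : 0 < ε) :
    ∀ᶠ z in atTop, |Real.log (deriv ψ z) - (v - 1) * Real.log z| ≤ ε * Real.log z := by
  obtain ⟨M, hM⟩ := (h.eventually_forall_deriv_pos hm hv hRV).exists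
  filter_upwards [h.eventually_mul_deriv hm hv hRV, h.eventually_abs_log_sub_le hRV (half_pos hε),
    eventually_ge_atTop M, eventually_gt_atTop 0,
    Real.tendsto_log_atTop.eventually_ge_atTop (Real.log (2 ^ v + 1) / (ε / 2)),
    Real.tendsto_log_atTop.eventually_ge_atTop (Real.log 2 / (ε / 2))] with z h1 h2 hzM hz h3 h4
  rw [div_le_iff₀ (half_pos hε)] at h3 h4
  obtain ⟨hd, hp⟩ := hM z hzM
  have h5 := Real.log_le_log (mul_pos hz hd) h1.1
  have h6 := Real.log_le_log hp h1.2
  have hzd := mul_pos hz hd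
  rw [Real.log_mul (by positivity) hp.ne', Real.log_mul hz.ne' hd.ne'] at h5
  rw [Real.log_mul (by norm_num) hzd.ne', Real.log_mul hz.ne' hd.ne'] at h6
  rw [abs_le] at h2 ⊢
  constructor <;> linarith [h2.1, h2.2]

lemma IsVonMises.tendsto_deriv_atTop : Tendsto (deriv ψ) atTop atTop := by
  have h1 : Tendsto (fun z => Real.exp ((v - 1) / 2 * Real.log z)) atTop atTop :=
    Real.tendsto_exp_atTop.comp (Real.tendsto_log_atTop.const_mul_atTop (by linarith))
  refine tendsto_atTop_mono' _ ?_ h1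
  obtain ⟨M, hM⟩ := (h.eventually_forall_deriv_pos hm hv hRV).exists
  filter_upwards [h.eventually_abs_log_deriv_sub_le hm hv hRV (show 0 < (v - 1) / 2 by linarith),
    eventually_ge_atTop M] with z hz hzM
  rw [← Real.le_log_iff_exp_le (hM z hzM).1]
  linarith [(abs_le.1 hz).1]

lemma IsVonMises.eventually_log_le {δ : ℝ} (hδ : 0 < δ) :
    ∀ᶠ z in atTop, Real.log z ≤ δ * ψ z := by
  obtain ⟨M, hM⟩ := (h.eventually_forall_deriv_pos hm hv hRV).exists
  filter_upwards [h.eventually_abs_log_sub_le hRV (show 0 < v - 1 by linarith),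
    eventually_ge_atTop M, eventually_gt_atTop 0,
    Real.isLittleO_log_id_atTop.bound hδ] with z h1 hzM hz h2
  have h3 : z ≤ ψ z := by
    rw [← Real.log_le_log_iff hz (hM z hzM).2]
    linarith [(abs_le.1 h1).1]
  simp only [id, Real.norm_eq_abs] at h2
  rw [abs_of_pos hz] at h2
  exact (le_abs_self _).trans (h2.trans (by gcongr))

/-- The derivative ψ' + b/z is positive once z ≥ 1 and ψ' > |b|. Both signs of b occur later. -/
lemma IsVonMises.exists_strictMonoOn_add_log (b : ℝ) :
    ∃ M, 0 < M ∧ StrictMonoOn (fun z => ψ z + b * Real.log z) (Set.Ici M) ∧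
      ContinuousOn (fun z => ψ z + b * Real.log z) (Set.Ici M) := by
  obtain ⟨M, hM⟩ := eventually_atTop.1 ((h.tendsto_deriv_atTop hm hv hRV).eventually_gt_atTop |b|)
  have hd : ∀ z, max M 1 ≤ z →
      HasDerivAt (fun z => ψ z + b * Real.log z) (deriv ψ z + b * z⁻¹) z := fun z hz =>
    have hz0 : 0 < z := zero_lt_one.trans_le ((le_max_right _ _).trans hz)
    (h.differentiableAt hz0).hasDerivAt.add ((Real.hasDerivAt_log hz0.ne').const_mul b)
  have hc : ContinuousOn (fun z => ψ z + b * Real.log z) (Set.Ici (max M 1)) := fun z hz =>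
    (hd z hz).continuousAt.continuousWithinAt
  refine ⟨max M 1, by positivity, strictMonoOn_of_deriv_pos (convex_Ici _) hc fun z hz => ?_, hc⟩
  rw [interior_Ici] at hz
  have hz' : max M 1 < z := hz
  rw [(hd z hz'.le).deriv]
  have h1 := hM z ((le_max_left _ _).trans hz'.le)
  have hz1 : 1 ≤ z := (le_max_right _ _).trans hz'.le
  have h2 : |b * z⁻¹| ≤ |b| := by
    rw [abs_mul, abs_of_pos (inv_pos.2 (zero_lt_one.trans_le hz1))]
    exact mul_le_of_le_one_right (abs_nonneg b) (inv_le_one_of_one_le₀ hz1)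
  linarith [neg_abs_le (b * z⁻¹)]

lemma IsVonMises.tendsto_add_log (b : ℝ) :
    Tendsto (fun z => ψ z + b * Real.log z) atTop atTop := by
  have h1 := h.tendsto_atTop.const_mul_atTop (show (0 : ℝ) < 1 / 2 by norm_num)
  refine tendsto_atTop_mono' _ ?_ h1
  filter_upwards [h.eventually_log_le hm hv hRV (δ := 1 / (2 * (|b| + 1))) (by positivity),
    eventually_ge_atTop 1] with z hz hz1
  have h2 := Real.log_nonneg hz1
  have h3 : (|b| + 1) * Real.log z ≤ 1 / 2 * ψ z := by
    have := mul_le_mul_of_nonneg_left hz (show 0 ≤ |b| + 1 by positivity)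
    have h4 : (|b| + 1) * (1 / (2 * (|b| + 1)) * ψ z) = 1 / 2 * ψ z := by field_simp
    linarith
  nlinarith [neg_abs_le b]

/-! ### Solutions of ψ z + b log z = log n -/

/-- The equation `ψ z + b log z = log n` has a solution that increases to infinity with `n`. -/
lemma IsVonMises.exists_seq (b : ℝ) :
    ∃ Z : ℕ → ℝ, Tendsto Z atTop atTop ∧
      (∀ᶠ n : ℕ in atTop, ψ (Z n) + b * Real.log (Z n) = Real.log n) ∧
      ∀ᶠ n₀ in atTop, ∀ m n, n₀ ≤ m → m < n → Z m < Z n := by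
  obtain ⟨M, hM0, hmono, hcont⟩ := h.exists_strictMonoOn_add_log hm hv hRV b
  have hlim := h.tendsto_add_log hm hv hRV b
  set φ := fun z => ψ z + b * Real.log z with hφ
  have hlog : Tendsto (fun n : ℕ => Real.log n) atTop atTop :=
    Real.tendsto_log_atTop.comp tendsto_natCast_atTop_atTop
  have hex : ∀ n : ℕ, ∃ z, φ M ≤ Real.log n → M ≤ z ∧ φ z = Real.log n := by
    intro n
    by_cases hn : φ M ≤ Real.log n
    · obtain ⟨K, hK, hMK⟩ := ((hlim.eventually_ge_atTop (Real.log n)).and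
        (eventually_ge_atTop M)).exists
      obtain ⟨z, hz, hz'⟩ := intermediate_value_Icc hMK (hcont.mono Set.Icc_subset_Ici_self)
        ⟨hn, hK⟩
      exact ⟨z, fun _ => ⟨hz.1, hz'⟩⟩
    · exact ⟨0, fun hn' => absurd hn' hn⟩
  choose Z hZ using hex
  refine ⟨Z, ?_, ?_, ?_⟩
  · refine Filter.tendsto_atTop.2 fun K => ?_
    filter_upwards [hlog.eventually_ge_atTop (φ M), hlog.eventually_ge_atTop (φ (max K M))]
      with n hn hn'
    obtain ⟨h1, h2⟩ := hZ n hn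
    rw [← h2] at hn'
    exact (le_max_left _ _).trans ((hmono.le_iff_le (le_max_right K M) h1).1 hn')
  · filter_upwards [hlog.eventually_ge_atTop (φ M)] with n hn
    exact (hZ n hn).2
  · filter_upwards [hlog.eventually_ge_atTop (φ M), eventually_gt_atTop 0] with n₀ hn hn0 m n hm' hmn
    have hm0 : (0 : ℝ) < m := Nat.cast_pos.2 (hn0.trans_le hm')
    have h1 : φ M ≤ Real.log m := hn.trans
      (Real.log_le_log (Nat.cast_pos.2 hn0) (Nat.cast_le.2 hm'))
    have h2 : Real.log m < Real.log n := Real.log_lt_log hm0 (Nat.cast_lt.2 hmn)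
    obtain ⟨h3, h4⟩ := hZ m h1
    obtain ⟨h5, h6⟩ := hZ n (h1.trans h2.le)
    rw [← h4, ← h6] at h2
    exact (hmono.lt_iff_lt h3 h5).1 h2

/-- Solutions of `ψ w + b log w = ψ z` are close to `z`. -/
lemma IsVonMises.exists_abs_sub_le (b : ℝ) {w z : ℕ → ℝ} (hw : Tendsto w atTop atTop)
    (hz : Tendsto z atTop atTop) (heq : ∀ᶠ n in atTop, ψ (w n) + b * Real.log (w n) = ψ (z n)) :
    (∀ᶠ n in atTop, z n ≤ 2 * w n ∧ w n ≤ 2 * z n) ∧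
      ∃ C, 0 < C ∧ ∀ᶠ n in atTop, |w n - z n| ≤ C * (Real.log (z n) / deriv ψ (z n)) := by
  obtain ⟨M, ⟨⟨hM1, hM2⟩, hM3⟩, hM4⟩ := (((h.eventually_forall_sub_le hm hv hRV).and
    (h.eventually_forall_deriv_pos hm hv hRV)).and (h.eventually_forall_le hm hv hRV)).and
    (h.eventually_deriv_mono hm hv hRV) |>.exists
  -- The term b log w is at most ψ(w)/8, so ψ(z) and ψ(w) differ by a factor close to 1, whereas
  -- doubling the argument at least doubles ψ.
  have e1 : ∀ᶠ n in atTop, z n ≤ 2 * w n ∧ w n ≤ 2 * z n := by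
    have e2 := h.eventually_log_le hm hv hRV (δ := 1 / (8 * (|b| + 1))) (by positivity)
    filter_upwards [heq, hw.eventually e2, hw.eventually_ge_atTop (max M 1),
      hz.eventually_ge_atTop (max M 1), hw.eventually (hRV.eventually_doubling hv),
      hz.eventually (hRV.eventually_doubling hv)] with n h1 h2 h3 h4 h5 h6
    have hw1 : 1 ≤ w n := (le_max_right _ _).trans h3
    have hwM : M ≤ w n := (le_max_left _ _).trans h3
    have hz1 : 1 ≤ z n := (le_max_right _ _).trans h4
    have hzM : M ≤ z n := (le_max_left _ _).trans h4
    have hl := Real.log_nonneg hw1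
    have h7 : (|b| + 1) * Real.log (w n) ≤ 1 / 8 * ψ (w n) := by
      have := mul_le_mul_of_nonneg_left h2 (show 0 ≤ |b| + 1 by positivity)
      have h8 : (|b| + 1) * (1 / (8 * (|b| + 1)) * ψ (w n)) = 1 / 8 * ψ (w n) := by field_simp
      linarith
    have h9 : |b * Real.log (w n)| ≤ 1 / 8 * ψ (w n) := by
      rw [abs_mul, abs_of_nonneg hl]
      linarith
    have h10 := abs_le.1 h9
    have hpw := (hM2 _ hwM).2
    have hpz := (hM2 _ hzM).2
    constructor
    · by_contra! hc
      have := hM3 (2 * w n) (z n) (by linarith) hc.le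
      linarith [h5.1]
    · by_contra! hc
      have := hM3 (2 * z n) (w n) (by linarith) hc.le
      linarith [h6.1]
  -- The factor 2|b| comes from log w ≤ 2 log z, the square from passing from ψ'(z/2) to ψ'(z); the
  -- summand 1 keeps C positive when b = 0.
  refine ⟨e1, 2 * |b| * (2 ^ v + 1) ^ 2 + 1, by positivity, ?_⟩
  have hz2 : Tendsto (fun n => z n / 2) atTop atTop := hz.atTop_div_const (by norm_num)
  filter_upwards [e1, heq, hz2.eventually (h.eventually_deriv_two_mul_le hm hv hRV),
    hz2.eventually_ge_atTop (max M 1)] with n h1 h2 h3 h4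
  have hM5 : M ≤ z n / 2 := (le_max_left _ _).trans h4
  have hz1 : 1 ≤ z n / 2 := (le_max_right _ _).trans h4
  rw [mul_div_cancel₀ (z n) (two_ne_zero' ℝ)] at h3
  have hl : Real.log (w n) ≤ 2 * Real.log (z n) := by
    rw [two_mul, ← Real.log_mul (by linarith) (by linarith)]
    exact Real.log_le_log (by linarith) (by nlinarith)
  have hl0 : 0 ≤ Real.log (w n) := Real.log_nonneg (by linarith)
  have hbl : |b * Real.log (w n)| ≤ 2 * |b| * Real.log (z n) := by
    rw [abs_mul, abs_of_nonneg hl0]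
    nlinarith [abs_nonneg b]
  have hd0 := (hM2 _ hM5).1
  -- Both w and z are at least z/2, so every slope between them is at least ψ'(z/2), while ψ changes
  -- by |b log w|.
  have key : deriv ψ (z n / 2) * |w n - z n| ≤ 2 * |b| * Real.log (z n) := by
    refine le_trans ?_ hbl
    rcases le_total (w n) (z n) with hwz | hwz
    · have h5 := (hM1 (w n) (z n) (by linarith) hwz).1
      have h6 := hM4 (z n / 2) (w n) hM5 (by linarith)
      rw [abs_of_nonpos (sub_nonpos.2 hwz), neg_sub]
      have h7 := mul_le_mul_of_nonneg_right h6 (sub_nonneg.2 hwz)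
      linarith [le_abs_self (b * Real.log (w n))]
    · have h5 := (hM1 (z n) (w n) (by linarith) hwz).1
      have h6 := hM4 (z n / 2) (z n) hM5 (by linarith)
      rw [abs_of_nonneg (sub_nonneg.2 hwz)]
      have h7 := mul_le_mul_of_nonneg_right h6 (sub_nonneg.2 hwz)
      linarith [neg_abs_le (b * Real.log (w n))]
  have hz0 := (hM2 (z n) (by linarith)).1
  rw [← mul_div_assoc, le_div_iff₀ hz0]
  have h8 := mul_le_mul_of_nonneg_right h3 (abs_nonneg (w n - z n))
  have h9 := mul_le_mul_of_nonneg_left key (show 0 ≤ ((2 : ℝ) ^ v + 1) ^ 2 by positivity)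
  have hlz : 0 ≤ Real.log (z n) := Real.log_nonneg (by linarith)
  nlinarith

/-- An asymptotic inverse is not assumed to diverge. For large n, however, it sends log n = ψ(Z n)
back to the solution Z n of the case b = 0, which does. -/
lemma tendsto_asymptoticInverse {g : ℝ → ℝ} (hg : IsAsymptoticInverse ψ g) :
    Tendsto (fun n : ℕ => g (Real.log n)) atTop atTop ∧
      ∀ᶠ n : ℕ in atTop, ψ (g (Real.log n)) = Real.log n := by
  have hlog : Tendsto (fun n : ℕ => Real.log n) atTop atTop :=
    Real.tendsto_log_atTop.comp tendsto_natCast_atTop_atTop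
  obtain ⟨Z, hZ, hZ', -⟩ := h.exists_seq hm hv hRV 0
  refine ⟨hZ.congr' ?_, hlog.eventually hg.2⟩
  filter_upwards [hZ', hZ.eventually hg.1] with n h1 h2
  rw [← h1, zero_mul, add_zero, h2]

end

/-! ### Poisson samples -/

section

variable {d : ℕ} {Ω : Type*} {N : Ω → ℕ} {X : ℕ → Ω → EuclideanSpace ℝ (Fin d)}

open Classical in
/-- The number of indices of sample points in `A`. -/
noncomputable def pointCount (N : Ω → ℕ) (X : ℕ → Ω → EuclideanSpace ℝ (Fin d))
    (A : Set (EuclideanSpace ℝ (Fin d))) (ω : Ω) : ℕ :=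
  ((Finset.range (N ω)).filter fun i => X i ω ∈ A).card

/-- The sample is a set, so equal points would merge. When they are distinct, its counts are counts
of indices, whose exponential moments are explicit. -/
lemma ncard_points_inter (A : Set (EuclideanSpace ℝ (Fin d))) {ω : Ω}
    (hω : ∀ i j, X i ω = X j ω → i = j) :
    (points N X ω ∩ A).ncard = pointCount N X A ω := by
  classical
  have h1 : points N X ω ∩ A =
      (fun i => X i ω) '' ((Finset.range (N ω)).filter fun i => X i ω ∈ A : Finset ℕ) := by
    ext x
    simp only [points, Set.mem_inter_iff, Set.mem_ofPred_eq, Finset.coe_filter, Finset.mem_range,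
      Set.mem_image]
    constructor
    · rintro ⟨⟨i, hi, rfl⟩, hA⟩
      exact ⟨i, ⟨hi, hA⟩, rfl⟩
    · rintro ⟨i, ⟨hi, hA⟩, rfl⟩
      exact ⟨⟨i, hi, rfl⟩, hA⟩
  rw [h1, Set.ncard_image_of_injective _ (fun i j hij => hω i j hij), Set.ncard_coe_finset]
  unfold pointCount
  congr

end

section PoissonSample

variable {d : ℕ} {Ω : Type*} [MeasurableSpace Ω] {μ : Measure Ω}
  {ν : Measure (EuclideanSpace ℝ (Fin d))} {n : ℕ} {N : Ω → ℕ}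
  {X : ℕ → Ω → EuclideanSpace ℝ (Fin d)}

/-- The generating functional of a Poisson sample. -/
lemma IsPoissonSample.lintegral_prod (hP : IsPoissonSample μ ν n N X)
    {f : EuclideanSpace ℝ (Fin d) → ℝ≥0∞} (hf : Measurable f) {a : ℝ} (ha : 0 ≤ a)
    (hfa : ∫⁻ x, f x ∂ν = ENNReal.ofReal a) :
    ∫⁻ ω, ∏ i ∈ Finset.range (N ω), f (X i ω) ∂μ = ENNReal.ofReal (Real.exp (n * (a - 1))) := by
  -- On {N = m} independence factors the integral into P(N = m) a^m; summing over m gives an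
  -- exponential series.
  have hterm : ∀ m : ℕ,
      ∫⁻ ω, (({m} : Set ℕ).indicator 1 (N ω) : ℝ≥0∞) * ∏ i ∈ Finset.range m, f (X i ω) ∂μ =
        ENNReal.ofReal (Real.exp (-n) * (n * a) ^ m / m.factorial) := by
    intro m
    have h1 : IndepFun (fun ω => (({m} : Set ℕ).indicator 1 (N ω) : ℝ≥0∞))
        (fun ω => ∏ i ∈ Finset.range m, f (X i ω)) μ :=
      hP.indep.comp (φ := fun k => (({m} : Set ℕ).indicator 1 k : ℝ≥0∞))
        (ψ := fun x : ℕ → EuclideanSpace ℝ (Fin d) => ∏ i ∈ Finset.range m, f (x i))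
        Measurable.of_discrete
        (Finset.measurable_prod _ fun i _ => hf.comp (measurable_pi_apply i))
    have h2 := lintegral_mul_eq_lintegral_mul_lintegral_of_indepFun
      ((Measurable.of_discrete (f := fun k => (({m} : Set ℕ).indicator 1 k : ℝ≥0∞))).comp
        hP.measurable_card)
      (Finset.measurable_prod (Finset.range m) fun i _ => hf.comp (hP.measurable_point i)) h1
    simp only [Pi.mul_apply, Function.comp] at h2
    rw [h2, lintegral_prod_eq_prod_lintegral_of_indepFun _ (fun i ω => f (X i ω))
      (hP.iIndep.comp (fun _ => f) fun _ => hf) fun i => hf.comp (hP.measurable_point i)]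
    have h3 : ∀ i, ∫⁻ ω, f (X i ω) ∂μ = ENNReal.ofReal a := fun i => by
      rw [← hfa, ← hP.law_point i, lintegral_map hf (hP.measurable_point i)]
    have h4 : ∫⁻ ω, (({m} : Set ℕ).indicator 1 (N ω) : ℝ≥0∞) ∂μ = poissonMeasure (n : ℝ≥0) {m} := by
      rw [← hP.law_card, ← lintegral_map (μ := μ) (g := N)
        (f := fun k => (({m} : Set ℕ).indicator 1 k : ℝ≥0∞)) Measurable.of_discrete
        hP.measurable_card]
      exact lintegral_indicator_one (measurableSet_singleton m)
    simp only [h3, Finset.prod_const, Finset.card_range]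
    rw [h4, poissonMeasure_singleton, ← ENNReal.ofReal_pow ha, ← ENNReal.ofReal_mul (by positivity)]
    congr 1
    simp only [NNReal.coe_natCast]
    rw [mul_pow]
    ring
  have hsum : ∀ ω, ∏ i ∈ Finset.range (N ω), f (X i ω) =
      ∑' m : ℕ, (({m} : Set ℕ).indicator 1 (N ω) : ℝ≥0∞) * ∏ i ∈ Finset.range m, f (X i ω) := by
    intro ω
    rw [tsum_eq_single (N ω)]
    · simp
    · intro m hm
      rw [Set.indicator_of_notMem (by simpa using hm.symm), zero_mul]
  simp_rw [hsum]
  rw [lintegral_tsum]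
  · simp_rw [hterm]
    have h5 : HasSum (fun m : ℕ => Real.exp (-n) * (n * a) ^ m / m.factorial)
        (Real.exp (n * (a - 1))) := by
      have h6 := (NormedSpace.expSeries_div_hasSum_exp ((n : ℝ) * a)).mul_left (Real.exp (-n))
      rw [← Real.exp_eq_exp_ℝ, ← Real.exp_add] at h6
      simp_rw [← mul_div_assoc] at h6
      rwa [show (n : ℝ) * (a - 1) = -n + n * a by ring]
    rw [← ENNReal.ofReal_tsum_of_nonneg (fun m => by positivity) h5.summable, h5.tsum_eq]
  · intro m
    exact (((Measurable.of_discrete (f := fun k => (({m} : Set ℕ).indicator 1 k : ℝ≥0∞))).comp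
        hP.measurable_card).mul (Finset.measurable_prod (Finset.range m)
          fun i _ => hf.comp (hP.measurable_point i))).aemeasurable

/-- The event that the sample has no point in `A`. -/
def emptyEvent (N : Ω → ℕ) (X : ℕ → Ω → EuclideanSpace ℝ (Fin d))
    (A : Set (EuclideanSpace ℝ (Fin d))) : Set Ω :=
  {ω | ∀ i < N ω, X i ω ∉ A}

lemma IsPoissonSample.measurableSet_emptyEvent (hP : IsPoissonSample μ ν n N X)
    {A : Set (EuclideanSpace ℝ (Fin d))} (hA : MeasurableSet A) :
    MeasurableSet (emptyEvent N X A) := by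
  have : emptyEvent N X A = ⋂ i, {ω | i < N ω}ᶜ ∪ (X i ⁻¹' A)ᶜ := by
    ext ω
    simp only [emptyEvent, Set.mem_ofPred_eq, Set.mem_iInter, Set.mem_union, Set.mem_compl_iff,
      Set.mem_preimage]
    exact forall_congr' fun i => by tauto
  rw [this]
  exact MeasurableSet.iInter fun i =>
    (measurableSet_lt measurable_const hP.measurable_card).compl.union
      (hP.measurable_point i hA).compl

lemma IsPoissonSample.measurable_pointCount (hP : IsPoissonSample μ ν n N X)
    {A : Set (EuclideanSpace ℝ (Fin d))} (hA : MeasurableSet A) :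
    Measurable (pointCount N X A) := by
  classical
  have h1 : Measurable fun p : ℕ × Ω =>
      ((Finset.range p.1).filter fun i => X i p.2 ∈ A).card := by
    refine measurable_from_prod_countable_right fun m => ?_
    simp only [Finset.card_filter]
    exact Finset.measurable_sum _ fun i _ =>
      Measurable.ite (hP.measurable_point i hA) measurable_const measurable_const
  convert! h1.comp (hP.measurable_card.prodMk measurable_id) using 1

variable [IsProbabilityMeasure μ]

lemma IsPoissonSample.isProbabilityMeasure (hP : IsPoissonSample μ ν n N X) :
    IsProbabilityMeasure ν := by
  rw [← hP.law_point 0]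
  exact Measure.isProbabilityMeasure_map (hP.measurable_point 0).aemeasurable

/-- This is the generating functional at the indicator of the complement of A, with integral 1 −
ν(A). -/
lemma IsPoissonSample.measureReal_emptyEvent (hP : IsPoissonSample μ ν n N X)
    {A : Set (EuclideanSpace ℝ (Fin d))} (hA : MeasurableSet A) :
    μ.real (emptyEvent N X A) = Real.exp (-(n * ν.real A)) := by
  have := hP.isProbabilityMeasure
  have h1 : ∫⁻ x, Aᶜ.indicator 1 x ∂ν = ENNReal.ofReal (1 - ν.real A) := by
    rw [lintegral_indicator_one hA.compl, ← probReal_compl_eq_one_sub hA, ofReal_measureReal]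
  have h2 := hP.lintegral_prod (measurable_one.indicator hA.compl)
    (sub_nonneg.2 measureReal_le_one) h1
  have h3 : ∀ ω, ∏ i ∈ Finset.range (N ω), (Aᶜ.indicator 1 (X i ω) : ℝ≥0∞) =
      (emptyEvent N X A).indicator 1 ω := by
    intro ω
    by_cases hω : ω ∈ emptyEvent N X A
    · rw [Set.indicator_of_mem hω]
      refine Finset.prod_eq_one fun i hi => ?_
      rw [Set.indicator_of_mem (hω i (Finset.mem_range.1 hi))]
      rfl
    · rw [Set.indicator_of_notMem hω]
      simp only [emptyEvent, Set.mem_ofPred_eq, not_forall, not_not] at hω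
      obtain ⟨i, hi, hiA⟩ := hω
      exact Finset.prod_eq_zero (Finset.mem_range.2 hi)
        (Set.indicator_of_notMem (Set.notMem_compl_iff.2 hiA) _)
  simp_rw [h3] at h2
  rw [lintegral_indicator_one (hP.measurableSet_emptyEvent hA)] at h2
  rw [measureReal_def, h2, ENNReal.toReal_ofReal (Real.exp_pos _).le]
  congr 1
  ring

/-- The probability that a set is hit is at most its intensity. -/
lemma IsPoissonSample.measure_compl_emptyEvent_le (hP : IsPoissonSample μ ν n N X)
    {A : Set (EuclideanSpace ℝ (Fin d))} (hA : MeasurableSet A) :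
    μ (emptyEvent N X A)ᶜ ≤ ENNReal.ofReal (n * ν.real A) := by
  rw [← ofReal_measureReal]
  refine ENNReal.ofReal_le_ofReal ?_
  rw [probReal_compl_eq_one_sub (hP.measurableSet_emptyEvent hA), hP.measureReal_emptyEvent hA]
  linarith [Real.add_one_le_exp (-(n * ν.real A))]

/-- For ν without atoms the diagonal is null for ν × ν, and there are countably many pairs of
indices. -/
lemma IsPoissonSample.ae_injective [NullSingletonClass ν] (hP : IsPoissonSample μ ν n N X) :
    ∀ᵐ ω ∂μ, ∀ i j, X i ω = X j ω → i = j := by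
  have := hP.isProbabilityMeasure
  rw [ae_all_iff]
  intro i
  rw [ae_all_iff]
  intro j
  by_cases hij : i = j
  · simp [hij]
  have h1 := (indepFun_iff_map_prod_eq_prod_map_map (hP.measurable_point i).aemeasurable
    (hP.measurable_point j).aemeasurable).1 (hP.iIndep.indepFun hij)
  rw [hP.law_point, hP.law_point] at h1
  have hD : MeasurableSet {p : EuclideanSpace ℝ (Fin d) × EuclideanSpace ℝ (Fin d) | p.1 = p.2} :=
    measurableSet_eq_fun measurable_fst measurable_snd
  have h2 : (ν.prod ν) {p | p.1 = p.2} = 0 := by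
    rw [Measure.measure_prod_null hD]
    refine Eventually.of_forall fun x => ?_
    have : Prod.mk x ⁻¹' {p : EuclideanSpace ℝ (Fin d) × EuclideanSpace ℝ (Fin d) | p.1 = p.2} =
        {x} := by
      ext y
      simp [eq_comm]
    simp [this]
  rw [← h1, Measure.map_apply ((hP.measurable_point i).prodMk (hP.measurable_point j)) hD] at h2
  rw [ae_iff]
  convert! h2 using 2
  ext ω
  simp [hij]

/-- The exponential moments of the Poisson counts. -/
lemma IsPoissonSample.lintegral_exp_pointCount (hP : IsPoissonSample μ ν n N X)
    {A : Set (EuclideanSpace ℝ (Fin d))} (hA : MeasurableSet A) (t : ℝ) :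
    ∫⁻ ω, ENNReal.ofReal (Real.exp (t * pointCount N X A ω)) ∂μ =
      ENNReal.ofReal (Real.exp (n * ν.real A * (Real.exp t - 1))) := by
  classical
  have := hP.isProbabilityMeasure
  have hf : Measurable (fun x => if x ∈ A then ENNReal.ofReal (Real.exp t) else 1) :=
    Measurable.ite hA measurable_const measurable_const
  have h1 : ∫⁻ x, (if x ∈ A then ENNReal.ofReal (Real.exp t) else 1) ∂ν =
      ENNReal.ofReal (Real.exp t * ν.real A + (1 - ν.real A)) := by
    rw [← lintegral_add_compl _ hA, setLIntegral_congr_fun hA (g := fun _ => ENNReal.ofReal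
      (Real.exp t)) (fun x hx => if_pos hx), setLIntegral_congr_fun hA.compl (g := fun _ => 1)
      (fun x hx => if_neg hx), setLIntegral_const, setLIntegral_const, one_mul,
      ENNReal.ofReal_add (by positivity) (sub_nonneg.2 measureReal_le_one),
      ENNReal.ofReal_mul (Real.exp_pos t).le, ofReal_measureReal,
      ← probReal_compl_eq_one_sub hA, ofReal_measureReal]
  have h2 := hP.lintegral_prod hf (a := Real.exp t * ν.real A + (1 - ν.real A))
    (add_nonneg (by positivity) (sub_nonneg.2 measureReal_le_one)) h1
  rw [show n * ν.real A * (Real.exp t - 1) =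
    n * (Real.exp t * ν.real A + (1 - ν.real A) - 1) by ring, ← h2]
  refine lintegral_congr fun ω => ?_
  rw [Finset.prod_ite, Finset.prod_const, Finset.prod_const_one, mul_one,
    ← ENNReal.ofReal_pow (Real.exp_pos t).le, ← Real.exp_nat_mul, mul_comm t]
  unfold pointCount
  congr

/-- The Chernoff bound for both tails of a Poisson count. -/
lemma IsPoissonSample.measure_pointCount_le (hP : IsPoissonSample μ ν n N X)
    {A : Set (EuclideanSpace ℝ (Fin d))} (hA : MeasurableSet A) {t : ℝ} (ht : |t| ≤ 1) :
    μ {ω | t * ((1 + 2 * t) * (n * ν.real A)) ≤ t * pointCount N X A ω} ≤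
      ENNReal.ofReal (Real.exp (-(n * ν.real A * t ^ 2))) := by
  -- The sign of t selects the tail: upper for t > 0, lower for t < 0. Markov's inequality for exp(t
  -- · count) and e^t − 1 − t ≤ t² leave the exponent l t² − 2 l t² = −l t².
  set l := n * ν.real A with hl
  have hl0 : 0 ≤ l := by positivity
  set c := Real.exp (t * ((1 + 2 * t) * l)) with hc
  have h1 := hP.lintegral_exp_pointCount hA t
  have h2 := meas_ge_le_lintegral_div (μ := μ)
    (f := fun ω => ENNReal.ofReal (Real.exp (t * pointCount N X A ω)))
    (ε := ENNReal.ofReal c) ?_ (by simp [hc, Real.exp_pos]) ENNReal.ofReal_ne_top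
  · rw [h1, ← ENNReal.ofReal_div_of_pos (Real.exp_pos _), ← Real.exp_sub] at h2
    refine (measure_mono fun ω hω => ?_).trans (h2.trans (ENNReal.ofReal_le_ofReal ?_))
    · exact ENNReal.ofReal_le_ofReal (Real.exp_le_exp.2 hω)
    · refine Real.exp_le_exp.2 ?_
      have h3 := (abs_le.1 (Real.abs_exp_sub_one_sub_id_le ht)).2
      nlinarith
  · exact (ENNReal.measurable_ofReal.comp (Real.measurable_exp.comp (measurable_const.mul
      (measurable_from_nat.comp (hP.measurable_pointCount hA))))).aemeasurable

/-- Two empty-set events differ in an event that is independent of the like event for disjoint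
sets. -/
lemma IsPoissonSample.indepSet_diff_emptyEvent (hP : IsPoissonSample μ ν n N X)
    {B C B' C' : Set (EuclideanSpace ℝ (Fin d))} (hB : MeasurableSet B) (hC : MeasurableSet C)
    (hB' : MeasurableSet B') (hC' : MeasurableSet C') (hCB : C ⊆ B) (hCB' : C' ⊆ B')
    (hd : Disjoint B B') :
    IndepSet (emptyEvent N X C \ emptyEvent N X B) (emptyEvent N X C' \ emptyEvent N X B') μ := by
  have := hP.isProbabilityMeasure
  have hanti : ∀ {S T : Set (EuclideanSpace ℝ (Fin d))}, S ⊆ T →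
      emptyEvent N X T ⊆ emptyEvent N X S := fun hST ω hω i hi hS => hω i hi (hST hS)
  have hinter : ∀ {S T : Set (EuclideanSpace ℝ (Fin d))}, S ⊆ B → T ⊆ B' → MeasurableSet S →
      MeasurableSet T → μ.real (emptyEvent N X S ∩ emptyEvent N X T) =
        μ.real (emptyEvent N X S) * μ.real (emptyEvent N X T) := by
    intro S T hS hT hSm hTm
    have h1 : emptyEvent N X S ∩ emptyEvent N X T = emptyEvent N X (S ∪ T) := by
      ext ω
      simp only [emptyEvent, Set.mem_inter_iff, Set.mem_ofPred_eq, Set.mem_union, not_or]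
      exact ⟨fun h i hi => ⟨h.1 i hi, h.2 i hi⟩, fun h => ⟨fun i hi => (h i hi).1,
        fun i hi => (h i hi).2⟩⟩
    rw [h1, hP.measureReal_emptyEvent (hSm.union hTm), hP.measureReal_emptyEvent hSm,
      hP.measureReal_emptyEvent hTm, ← Real.exp_add,
      measureReal_union (hd.mono hS hT) hTm]
    congr 1
    ring
  have mB := hP.measurableSet_emptyEvent hB
  have mC := hP.measurableSet_emptyEvent hC
  have mB' := hP.measurableSet_emptyEvent hB'
  have mC' := hP.measurableSet_emptyEvent hC'
  rw [indepSet_iff_measure_inter_eq_mul (mC.diff mB) (mC'.diff mB') μ]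
  -- Iterated differences of nested events: the probability becomes an alternating sum of four void
  -- probabilities, each of which factors because disjoint sets have additive measure.
  have h2 : (emptyEvent N X C \ emptyEvent N X B) ∩ (emptyEvent N X C' \ emptyEvent N X B') =
      ((emptyEvent N X C ∩ emptyEvent N X C') \ (emptyEvent N X B ∩ emptyEvent N X C')) \
      ((emptyEvent N X C ∩ emptyEvent N X B') \ (emptyEvent N X B ∩ emptyEvent N X B')) := by
    ext ω
    have h3 : ω ∈ emptyEvent N X B → ω ∈ emptyEvent N X C := fun h => hanti hCB h
    simp only [Set.mem_inter_iff, Set.mem_sdiff]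
    tauto
  have h4 : μ.real ((emptyEvent N X C \ emptyEvent N X B) ∩
      (emptyEvent N X C' \ emptyEvent N X B')) =
      μ.real (emptyEvent N X C \ emptyEvent N X B) *
        μ.real (emptyEvent N X C' \ emptyEvent N X B') := by
    rw [h2, measureReal_sdiff _ ((mC.inter mB').diff (mB.inter mB')),
      measureReal_sdiff (Set.inter_subset_inter_left _ (hanti hCB)) (mB.inter mC'),
      measureReal_sdiff (Set.inter_subset_inter_left _ (hanti hCB)) (mB.inter mB'),
      measureReal_sdiff (hanti hCB) mB, measureReal_sdiff (hanti hCB') mB',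
      hinter hCB hCB' hC hC', hinter subset_rfl hCB' hB hC', hinter hCB subset_rfl hC hB',
      hinter subset_rfl subset_rfl hB hB']
    · ring
    · intro ω hω
      exact ⟨⟨hω.1.1, hanti hCB' hω.1.2⟩, fun h => hω.2 ⟨h.1, hω.1.2⟩⟩
  rw [← ofReal_measureReal, h4, ENNReal.ofReal_mul measureReal_nonneg, ofReal_measureReal,
    ofReal_measureReal]

/-- If pairwise independent events have a large expected number, two of them are likely to occur. -/
lemma measure_not_two_le {E : ℕ → Set Ω} {K : ℕ} (hE : ∀ k < K, MeasurableSet (E k))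
    (hind : ∀ k < K, ∀ l < K, k ≠ l → IndepSet (E k) (E l) μ) {m : ℝ} (hm : 2 ≤ m)
    (hsum : m ≤ ∑ k ∈ Finset.range K, μ.real (E k)) :
    μ {ω | ¬ ∃ k < K, ∃ l < K, k ≠ l ∧ ω ∈ E k ∧ ω ∈ E l} ≤ ENNReal.ofReal (4 / m) := by
  classical
  set Y : ℕ → Ω → ℝ := fun k => (E k).indicator 1 with hY
  have hYm : ∀ k ∈ Finset.range K, MemLp (Y k) 2 μ := fun k hk =>
    memLp_indicator_const 2 (hE k (Finset.mem_range.1 hk)) 1 (Or.inr (measure_ne_top _ _))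
  have hint : ∀ k ∈ Finset.range K, μ[Y k] = μ.real (E k) := fun k hk =>
    integral_indicator_one (hE k (Finset.mem_range.1 hk))
  have hvar : ∀ k ∈ Finset.range K, variance (Y k) μ ≤ μ.real (E k) := by
    intro k hk
    refine (variance_le_expectation_sq (hYm k hk).1).trans_eq ?_
    rw [← hint k hk]
    congr 1
    ext ω
    by_cases hω : ω ∈ E k <;> simp [hY, hω]
  have hpair : Set.Pairwise (↑(Finset.range K)) fun i j => IndepFun (Y i) (Y j) μ := by
    intro i hi j hj hij
    have hcomap : ∀ k, MeasurableSpace.comap (Y k) inferInstance ≤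
        MeasurableSpace.generateFrom {E k} := fun k => Measurable.comap_le
      (Measurable.indicator (m := MeasurableSpace.generateFrom {E k}) measurable_const
        (MeasurableSpace.measurableSet_generateFrom (Set.mem_singleton _)))
    have h0 := hind i (Finset.mem_range.1 hi) j (Finset.mem_range.1 hj) hij
    rw [IndepSet_iff_Indep] at h0
    exact (IndepFun_iff_Indep _ _ _).2
      (indep_of_indep_of_le_left (indep_of_indep_of_le_right h0 (hcomap j)) (hcomap i))
  set S := ∑ k ∈ Finset.range K, μ.real (E k) with hS
  have hS2 : 0 < S := by linarith
  have h1 : μ[∑ k ∈ Finset.range K, Y k] = S := by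
    simp only [Finset.sum_apply]
    rw [integral_finsetSum _ fun k hk => (hYm k hk).integrable (by norm_num)]
    exact Finset.sum_congr rfl hint
  have h2 : variance (∑ k ∈ Finset.range K, Y k) μ ≤ S := by
    rw [IndepFun.variance_sum hYm hpair]
    exact Finset.sum_le_sum hvar
  -- Chebyshev: pairwise independence gives variance at most the mean S, and at most one occurrence
  -- is a deviation of at least S/2 because S ≥ 2.
  have h3 := meas_ge_le_variance_div_sq (memLp_finsetSum' _ hYm) (half_pos hS2)
  rw [h1] at h3
  refine (measure_mono fun ω hω => ?_).trans (h3.trans (ENNReal.ofReal_le_ofReal ?_))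
  · have h4 : (∑ k ∈ Finset.range K, Y k) ω ≤ 1 := by
      have h5 : (∑ k ∈ Finset.range K, Y k) ω =
          (((Finset.range K).filter fun k => ω ∈ E k).card : ℝ) := by
        simp [Finset.sum_apply, hY, Set.indicator_apply]
      rw [h5]
      norm_cast
      refine Finset.card_le_one.2 fun k hk l hl => ?_
      by_contra hkl
      simp only [Finset.mem_filter, Finset.mem_range] at hk hl
      exact hω ⟨k, hk.1, l, hl.1, hkl, hk.2, hl.2⟩
    change S / 2 ≤ |_ - S|
    rw [abs_sub_comm]
    exact le_trans (by linarith) (le_abs_self _)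
  · calc _ ≤ S / (S / 2) ^ 2 := by gcongr
      _ = 4 / S := by field_simp; norm_num
      _ ≤ 4 / m := by gcongr

end PoissonSample

/-! ### Disconnectedness -/

section

variable {d : ℕ} {q : EuclideanSpace ℝ (Fin d) → ℝ}

lemma IsRadialDensity.isProbabilityMeasure (hq : IsRadialDensity q) :
    IsProbabilityMeasure (densityMeasure q) :=
  ⟨by rw [densityMeasure, withDensity_apply _ MeasurableSet.univ, setLIntegral_univ,
    hq.lintegral_eq_one]⟩

lemma densityMeasure_real_le {S : Set (EuclideanSpace ℝ (Fin d))} (hS : MeasurableSet S)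
    (hv : volume S ≠ ∞) {c : ℝ} (hc : 0 ≤ c) (h : ∀ x ∈ S, q x ≤ c) :
    (densityMeasure q).real S ≤ c * volume.real S := by
  have h1 : densityMeasure q S ≤ ENNReal.ofReal c * volume S := by
    rw [densityMeasure, withDensity_apply _ hS, ← setLIntegral_const]
    exact setLIntegral_mono' hS fun x hx => ENNReal.ofReal_le_ofReal (h x hx)
  have h2 := ENNReal.toReal_mono (ENNReal.mul_ne_top ENNReal.ofReal_ne_top hv) h1
  rwa [ENNReal.toReal_mul, ENNReal.toReal_ofReal hc] at h2

lemma IsRadialDensity.mul_volume_le (hq : IsRadialDensity q)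
    {S : Set (EuclideanSpace ℝ (Fin d))} (hS : MeasurableSet S) {c : ℝ} (hc : 0 ≤ c)
    (h : ∀ x ∈ S, c ≤ q x) :
    c * volume.real S ≤ (densityMeasure q).real S := by
  have := hq.isProbabilityMeasure
  have h1 : ENNReal.ofReal c * volume S ≤ densityMeasure q S := by
    rw [densityMeasure, withDensity_apply _ hS, ← setLIntegral_const]
    exact setLIntegral_mono' hS fun x hx => ENNReal.ofReal_le_ofReal (h x hx)
  have h2 := ENNReal.toReal_mono (measure_ne_top _ _) h1
  rwa [ENNReal.toReal_mul, ENNReal.toReal_ofReal hc] at h2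

end

lemma volumeReal_ball {d : ℕ} (x : EuclideanSpace ℝ (Fin d)) {ρ : ℝ} (hρ : 0 < ρ) :
    volume.real (Metric.ball x ρ) =
      ρ ^ d * volume.real (Metric.ball (0 : EuclideanSpace ℝ (Fin d)) 1) := by
  rw [measureReal_def, Measure.addHaar_ball_of_pos _ _ hρ, ENNReal.toReal_mul,
    ENNReal.toReal_ofReal (by positivity), finrank_euclideanSpace_fin, measureReal_def]

/-- A point of norm `R` whose second coordinate is `t`. -/
lemma exists_norm_eq_apply_eq {d : ℕ} (hd : 2 ≤ d) {R t : ℝ} (ht : 0 ≤ t) (htR : t ≤ R) :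
    ∃ y : EuclideanSpace ℝ (Fin d), ‖y‖ = R ∧ y ⟨1, hd⟩ = t := by
  have h01 : (⟨0, by omega⟩ : Fin d) ≠ ⟨1, hd⟩ := by simp
  refine ⟨EuclideanSpace.single ⟨0, by omega⟩ (Real.sqrt (R ^ 2 - t ^ 2)) +
    EuclideanSpace.single ⟨1, hd⟩ t, ?_, ?_⟩
  · have h1 := norm_add_sq_eq_norm_sq_add_norm_sq_real
      (x := (EuclideanSpace.single ⟨0, by omega⟩ (Real.sqrt (R ^ 2 - t ^ 2)) :
        EuclideanSpace ℝ (Fin d))) (y := EuclideanSpace.single ⟨1, hd⟩ t)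
      (by simp [EuclideanSpace.inner_single_left])
    rw [PiLp.norm_single, PiLp.norm_single, Real.norm_eq_abs, Real.norm_eq_abs, abs_mul_abs_self,
      abs_mul_abs_self, Real.mul_self_sqrt (by nlinarith)] at h1
    have h2 : 0 ≤ R := ht.trans htR
    refine (mul_self_inj (norm_nonneg _) h2).1 (h1.trans (by ring))
  · simp

/-- A cluster that no edge leaves and a point outside it make a graph disconnected. -/
lemma disconnected_of_isolated {d : ℕ} {P : Set (EuclideanSpace ℝ (Fin d))} {r ρ : ℝ} (hr : r ≤ ρ)
    {y a b : EuclideanSpace ℝ (Fin d)}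
    (hC : ∀ x ∈ P, x ∉ Metric.ball y (2 * ρ) \ Metric.ball y ρ) (ha : a ∈ P)
    (hay : a ∈ Metric.ball y ρ) (hb : b ∈ P) (hby : b ∉ Metric.ball y ρ) :
    Disconnected (geometricGraph P r) := by
  have hadj : ∀ u w : P, (geometricGraph P r).Adj u w →
      (u : EuclideanSpace ℝ (Fin d)) ∈ Metric.ball y ρ →
        (w : EuclideanSpace ℝ (Fin d)) ∈ Metric.ball y ρ := by
    intro u w huw hu
    by_contra hw
    refine hC w w.2 ((Set.mem_sdiff _).2 ⟨?_, hw⟩)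
    have h1 : dist (u : EuclideanSpace ℝ (Fin d)) w < r := huw.2
    rw [Metric.mem_ball] at hu ⊢
    linarith [dist_triangle_left (w : EuclideanSpace ℝ (Fin d)) y u]
  have key : ∀ u w : P, (geometricGraph P r).Walk u w →
      (u : EuclideanSpace ℝ (Fin d)) ∈ Metric.ball y ρ →
        (w : EuclideanSpace ℝ (Fin d)) ∈ Metric.ball y ρ := by
    intro u w p
    induction p with
    | nil => exact id
    | cons huv _ ih => exact fun hu => ih (hadj _ _ huv hu)
  intro hconn
  refine (hconn ⟨a, ha⟩ ⟨b, hb⟩).elim fun p => ?_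
  have h1 : (⟨b, hb⟩ : P).1 ∈ Metric.ball y ρ := key ⟨a, ha⟩ ⟨b, hb⟩ p hay
  exact absurd h1 hby

/-- A lower bound for the probability that a Poisson sample with intensity of moderate size near
the sphere of radius `R` has a disconnected graph. -/
lemma IsPoissonSample.measure_not_disconnected_le {d : ℕ} (hd : 2 ≤ d)
    {q : EuclideanSpace ℝ (Fin d) → ℝ} (hq : IsRadialDensity q) {Ω : Type*} [MeasurableSpace Ω]
    {μ : Measure Ω} [IsProbabilityMeasure μ] {n : ℕ} {N : Ω → ℕ}
    {X : ℕ → Ω → EuclideanSpace ℝ (Fin d)} (hP : IsPoissonSample μ (densityMeasure q) n N X)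
    {r ρ R lo hi V : ℝ} (hr : r ≤ ρ) (hρ : 0 < ρ) (hR : 4 * ρ ≤ R) (hlo : 0 < lo) (hhi : 0 < hi)
    (hV : V = volume.real (Metric.ball (0 : EuclideanSpace ℝ (Fin d)) 1))
    (hq1 : ∀ x : EuclideanSpace ℝ (Fin d), |‖x‖ - R| ≤ 2 * ρ → lo ≤ n * q x ∧ n * q x ≤ hi)
    (hsmall : hi * ((2 * ρ) ^ d * V) ≤ 1) (hbig : 2 ≤ R / (8 * ρ) * (lo * (ρ ^ d * V) / 6)) :
    μ {ω | ¬ Disconnected (geometricGraph (points N X ω) r)} ≤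
      ENNReal.ofReal (4 / (R / (8 * ρ) * (lo * (ρ ^ d * V) / 6))) := by
  have := hq.isProbabilityMeasure
  have hn : (0 : ℝ) < n := by
    obtain ⟨x, hx, -⟩ := exists_norm_eq_apply_eq hd le_rfl (show 0 ≤ R by linarith)
    have h1 := (hq1 x (by rw [hx, sub_self, abs_zero]; positivity)).1
    refine lt_of_le_of_ne n.cast_nonneg fun h0 => ?_
    rw [← h0, zero_mul] at h1
    linarith
  -- The centres lie on the sphere of radius R with second coordinates 4ρk. These fit below R for k
  -- < K and are 4ρ apart, so the balls of radius 2ρ are disjoint.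
  set K := ⌊R / (4 * ρ)⌋₊ with hK
  have hR4 : 1 ≤ R / (4 * ρ) := by rwa [one_le_div (by positivity)]
  have hKR : (K : ℝ) ≤ R / (4 * ρ) := Nat.floor_le (by linarith)
  have hKlow : R / (8 * ρ) ≤ K := by
    have h1 := Nat.lt_floor_add_one (R / (4 * ρ))
    have h2 : (1 : ℝ) ≤ K := by exact_mod_cast (Nat.one_le_floor_iff _).2 hR4
    have h3 : R / (8 * ρ) = R / (4 * ρ) / 2 := by field_simp; ring
    rw [h3]
    linarith
  have hex : ∀ k : ℕ, ∃ y : EuclideanSpace ℝ (Fin d), k < K →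
      ‖y‖ = R ∧ y ⟨1, hd⟩ = 4 * ρ * k := by
    intro k
    by_cases hk : k < K
    · have h1 : 4 * ρ * k ≤ R := by
        have h2 : (k : ℝ) ≤ R / (4 * ρ) := (Nat.cast_le.2 hk.le).trans hKR
        rw [le_div_iff₀ (by positivity)] at h2
        linarith
      obtain ⟨y, hy⟩ := exists_norm_eq_apply_eq hd (by positivity) h1
      exact ⟨y, fun _ => hy⟩
    · exact ⟨0, fun h => absurd h hk⟩
  choose y hy using hex
  set B := fun k => Metric.ball (y k) (2 * ρ) with hB
  set C := fun k => Metric.ball (y k) (2 * ρ) \ Metric.ball (y k) ρ with hC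
  have mB : ∀ k, MeasurableSet (B k) := fun k => measurableSet_ball
  have mC : ∀ k, MeasurableSet (C k) := fun k => measurableSet_ball.diff measurableSet_ball
  have hdisj : ∀ k < K, ∀ l < K, k ≠ l → Disjoint (B k) (B l) := by
    intro k hk l hl hkl
    refine Metric.ball_disjoint_ball ?_
    have h1 := PiLp.norm_apply_le (y k - y l) ⟨1, hd⟩
    rw [PiLp.sub_apply, (hy k hk).2, (hy l hl).2, ← mul_sub, Real.norm_eq_abs, abs_mul,
      abs_of_pos (by positivity : (0 : ℝ) < 4 * ρ)] at h1
    have h2 : (1 : ℝ) ≤ |(k : ℝ) - l| := by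
      have : (1 : ℤ) ≤ |(k : ℤ) - l| := Int.one_le_abs (sub_ne_zero.2 (by exact_mod_cast hkl))
      exact_mod_cast this
    rw [dist_eq_norm]
    nlinarith
  have hshell : ∀ k < K, ∀ x ∈ B k, |‖x‖ - R| ≤ 2 * ρ := by
    intro k hk x hx
    rw [← (hy k hk).1]
    exact (abs_norm_sub_norm_le x (y k)).trans (mem_ball_iff_norm.1 hx).le
  have hprob : ∀ k < K, lo * (ρ ^ d * V) / 6 ≤
      μ.real (emptyEvent N X (C k) \ emptyEvent N X (B k)) := by
    intro k hk
    have hsub : emptyEvent N X (B k) ⊆ emptyEvent N X (C k) :=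
      fun ω hω i hi hS => hω i hi (Set.sdiff_subset hS)
    rw [measureReal_sdiff hsub (hP.measurableSet_emptyEvent (mB k)),
      hP.measureReal_emptyEvent (mB k), hP.measureReal_emptyEvent (mC k)]
    have h1 : n * (densityMeasure q).real (B k) ≤ 1 := by
      have h2 := densityMeasure_real_le (q := q) (mB k) measure_ball_lt_top.ne
        (c := hi / n) (by positivity) fun x hx => by
          rw [le_div_iff₀ hn, mul_comm]
          exact (hq1 x (hshell k hk x hx)).2
      rw [volumeReal_ball _ (by positivity), ← hV] at h2
      have h3 := mul_le_mul_of_nonneg_left h2 hn.le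
      rw [← mul_assoc, mul_div_cancel₀ _ hn.ne'] at h3
      exact h3.trans hsmall
    have h4 : lo * (ρ ^ d * V) ≤ n * (densityMeasure q).real (Metric.ball (y k) ρ) := by
      have h2 := hq.mul_volume_le (S := Metric.ball (y k) ρ) measurableSet_ball
        (c := lo / n) (by positivity) fun x hx => by
          rw [div_le_iff₀ hn, mul_comm]
          exact (hq1 x (hshell k hk x (Metric.ball_subset_ball (by linarith) hx))).1
      rw [volumeReal_ball _ (by positivity), ← hV] at h2
      have h3 := mul_le_mul_of_nonneg_left h2 hn.le
      rwa [← mul_assoc, mul_div_cancel₀ _ hn.ne'] at h3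
    have h5 : (densityMeasure q).real (B k) =
        (densityMeasure q).real (C k) + (densityMeasure q).real (Metric.ball (y k) ρ) := by
      rw [measureReal_sdiff (Metric.ball_subset_ball (by linarith)) measurableSet_ball]
      ring
    set a := n * (densityMeasure q).real (Metric.ball (y k) ρ)
    set c := n * (densityMeasure q).real (C k)
    have hac : n * (densityMeasure q).real (B k) = c + a := by rw [h5]; ring
    have hc0 : 0 ≤ c := by positivity
    have ha0 : 0 ≤ a := by positivity
    rw [hac] at h1 ⊢
    -- The event has probability e^(−c) − e^(−(c+a)), with a the mean of the inner ball and c that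
    -- of the shell. As a + c ≤ 1, e^(−a) ≤ 1 − a/2 and e^(−c) ≥ 1/3, whence a/6.
    have h6 : Real.exp (-(c + a)) ≤ Real.exp (-c) * (1 - a / 2) := by
      rw [neg_add, Real.exp_add]
      refine mul_le_mul_of_nonneg_left ?_ (Real.exp_pos _).le
      have h7 : Real.exp (-a) * (1 + a) ≤ 1 := by
        rw [Real.exp_neg, inv_mul_le_iff₀ (Real.exp_pos a), mul_one, add_comm]
        exact Real.add_one_le_exp a
      nlinarith [Real.exp_pos (-a)]
    have h10 : 1 / 3 ≤ Real.exp (-c) := by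
      have h11 : Real.exp c ≤ 3 := (Real.exp_le_exp.2 (by linarith : c ≤ 1)).trans
        (Real.exp_one_lt_d9.le.trans (by norm_num))
      rw [Real.exp_neg, ← one_div]
      exact one_div_le_one_div_of_le (Real.exp_pos _) h11
    nlinarith
  have hmain := measure_not_two_le (μ := μ)
    (E := fun k => emptyEvent N X (C k) \ emptyEvent N X (B k)) (K := K)
    (fun k _ => (hP.measurableSet_emptyEvent (mC k)).diff (hP.measurableSet_emptyEvent (mB k)))
    (fun k hk l hl hkl => hP.indepSet_diff_emptyEvent (mB k) (mC k) (mB l) (mC l)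
      Set.sdiff_subset Set.sdiff_subset (hdisj k hk l hl hkl)) hbig ?_
  -- Two events are needed: one gives an isolated cluster, the other a point outside it.
  · refine (measure_mono fun ω hω => ?_).trans hmain
    rintro ⟨k, hk, l, hl, hkl, hωk, hωl⟩
    apply hω
    have hpt : ∀ k, ω ∈ emptyEvent N X (C k) \ emptyEvent N X (B k) →
        ∃ x ∈ points N X ω, x ∈ Metric.ball (y k) ρ := by
      intro k hk
      have h1 := hk.2
      simp only [emptyEvent, Set.mem_ofPred_eq, not_forall, not_not] at h1
      obtain ⟨i, hi, hiB⟩ := h1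
      refine ⟨X i ω, ⟨i, hi, rfl⟩, ?_⟩
      by_contra hA
      exact hk.1 i hi ⟨hiB, hA⟩
    obtain ⟨a, haP, ha⟩ := hpt k hωk
    obtain ⟨b, hbP, hb⟩ := hpt l hωl
    refine disconnected_of_isolated hr (y := y k) ?_ haP ha hbP fun hb' => ?_
    · rintro x ⟨i, hi, rfl⟩
      exact hωk.1 i hi
    · exact Set.disjoint_left.1 (hdisj k hk l hl hkl)
        (Metric.ball_subset_ball (by linarith) hb') (Metric.ball_subset_ball (by linarith) hb)
  · calc R / (8 * ρ) * (lo * (ρ ^ d * V) / 6) ≤ K * (lo * (ρ ^ d * V) / 6) := by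
          have : 0 ≤ V := hV ▸ measureReal_nonneg
          gcongr
      _ = ∑ k ∈ Finset.range K, lo * (ρ ^ d * V) / 6 := by simp
      _ ≤ _ := Finset.sum_le_sum fun k hk => hprob k (Finset.mem_range.1 hk)

/-! ### Asymptotics along the solutions of `ψ z = log n` -/

/-- A light-tailed density is `|x| ^ (α + o(1)) exp (-ψ |x|)`. -/
lemma IsRadialDensity.eventually_abs_log_add_sub_le {d : ℕ} (hd : 2 ≤ d)
    {q : EuclideanSpace ℝ (Fin d) → ℝ} (hq : IsRadialDensity q) {ψ L : ℝ → ℝ} {α : ℝ}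
    (h : IsVonMises ψ) (hL : RegularlyVarying L α)
    (hqL : ∀ x, q x = L ‖x‖ * Real.exp (-ψ ‖x‖)) {ε : ℝ} (hε : 0 < ε) :
    ∀ᶠ z in atTop, ∀ x, ‖x‖ = z →
      |Real.log (q x) + ψ z - α * Real.log z| ≤ ε * Real.log z := by
  have hLeq : ∀ x, L ‖x‖ = q x * Real.exp (ψ ‖x‖) := fun x => by
    rw [hqL, mul_assoc, ← Real.exp_add, neg_add_cancel, Real.exp_zero, mul_one]
  have hlog : ∀ x, Real.log (L ‖x‖) = Real.log (q x) + ψ ‖x‖ := fun x => by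
    rw [hLeq, Real.log_mul (hq.pos x).ne' (Real.exp_pos _).ne', Real.log_exp]
  obtain ⟨e, he, -⟩ := exists_norm_eq_apply_eq hd le_rfl zero_le_one
  -- Measurability of L is not assumed; it is read off from q along the ray through the unit vector
  -- `e`.
  have hm : Measurable fun x => Real.log (L (Real.exp x)) := by
    have h1 : ∀ x, Real.log (L (Real.exp x)) =
        Real.log (q (Real.exp x • e)) + ψ (Real.exp x) := by
      intro x
      have h2 : ‖Real.exp x • e‖ = Real.exp x := by
        rw [norm_smul, he, mul_one, Real.norm_eq_abs, abs_of_pos (Real.exp_pos x)]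
      have h3 := hlog (Real.exp x • e)
      rwa [h2] at h3
    simp_rw [h1]
    exact (Real.measurable_log.comp (hq.measurable.comp
      (Real.measurable_exp.smul measurable_const))).add h.continuous_comp_exp.measurable
  filter_upwards [hL.eventually_abs_log_sub_le hm hε] with z hz x hx
  rwa [← hx, ← hlog, hx]

section

variable {ψ : ℝ → ℝ} {v : ℝ} (h : IsVonMises ψ) (hm : EventuallyMonotone (deriv ψ)) (hv : 1 < v)
  (hRV : RegularlyVarying ψ v) {b : ℝ} {w z : ℕ → ℝ} (hw : Tendsto w atTop atTop)
  (hz : Tendsto z atTop atTop)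
  (hwn : ∀ᶠ n : ℕ in atTop, ψ (w n) + b * Real.log (w n) = Real.log n)
  (hzn : ∀ᶠ n : ℕ in atTop, ψ (z n) = Real.log n)

include hw hz in
lemma eventually_abs_log_sub_log_le (hwz : ∀ᶠ n in atTop, z n ≤ 2 * w n ∧ w n ≤ 2 * z n)
    {ε : ℝ} (hε : 0 < ε) :
    ∀ᶠ n in atTop, |Real.log (z n) - Real.log (w n)| ≤ ε * Real.log (w n) := by
  filter_upwards [hwz, hw.eventually_gt_atTop 0, hz.eventually_gt_atTop 0,
    (Real.tendsto_log_atTop.comp hw).eventually_ge_atTop (Real.log 2 / ε)] with n h1 h2 h3 h4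
  simp only [Function.comp] at h4
  rw [div_le_iff₀ hε] at h4
  have h5 := Real.log_le_log h3 h1.1
  have h6 := Real.log_le_log h2 h1.2
  rw [Real.log_mul (by norm_num) h2.ne'] at h5
  rw [Real.log_mul (by norm_num) h3.ne'] at h6
  rw [abs_le]
  constructor <;> linarith

include h hRV hv hz hzn in
/-- `log log n` is of the order of `log z` when `ψ z = log n`. -/
lemma isTheta_log_log :
    (fun n : ℕ => Real.log (Real.log n)) =Θ[atTop] fun n => Real.log (z n) := by
  -- With error v/2, log log n = log ψ(z) lies between (v/2) log z and (3v/2) log z.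
  have e := hz.eventually (h.eventually_abs_log_sub_le hRV (show 0 < v / 2 by linarith))
  have hl := (Real.tendsto_log_atTop.comp hz).eventually_ge_atTop 0
  refine ⟨IsBigO.of_bound (2 * v) ?_, IsBigO.of_bound (2 / v) ?_⟩
  · filter_upwards [e, hzn, hl] with n h1 h2 h3
    simp only [Function.comp] at h3
    rw [h2, abs_le] at h1
    rw [Real.norm_eq_abs, Real.norm_eq_abs, abs_of_nonneg h3, abs_le]
    constructor <;> nlinarith
  · filter_upwards [e, hzn, hl] with n h1 h2 h3
    simp only [Function.comp] at h3
    rw [h2, abs_le] at h1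
    rw [Real.norm_eq_abs, Real.norm_eq_abs, abs_of_nonneg h3, div_mul_eq_mul_div,
      le_div_iff₀ (by linarith)]
    nlinarith [le_abs_self (Real.log (Real.log n))]

include h hm hv hRV hw hz hwn hzn

/-- Exponents are measured in powers of w from here on. Replacing z by w costs o(log w), since they
agree up to a factor 2. -/
lemma eventually_abs_log_deriv_sub_le {ε : ℝ} (hε : 0 < ε) :
    ∀ᶠ n in atTop,
      |Real.log (deriv ψ (z n)) - (v - 1) * Real.log (w n)| ≤ ε * Real.log (w n) := by
  -- The errors are 2δ from ψ' at z and (v − 1)δ from the change to log w, together (v + 1)δ; δ ≤ 1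
  -- ensures log z ≤ 2 log w.
  have hδ : 0 < min 1 (ε / (v + 1)) := lt_min one_pos (div_pos hε (by linarith))
  have heq : ∀ᶠ n in atTop, ψ (w n) + b * Real.log (w n) = ψ (z n) := by
    filter_upwards [hwn, hzn] with n h1 h2 using h1.trans h2.symm
  have hwz := (h.exists_abs_sub_le hm hv hRV b hw hz heq).1
  filter_upwards [hz.eventually (h.eventually_abs_log_deriv_sub_le hm hv hRV hδ),
    eventually_abs_log_sub_log_le hw hz hwz hδ,
    (Real.tendsto_log_atTop.comp hw).eventually_ge_atTop 0] with n h1 h2 h3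
  simp only [Function.comp] at h3
  set δ := min 1 (ε / (v + 1))
  have hδ1 : δ ≤ 1 := min_le_left _ _
  have hδ2 : δ * (v + 1) ≤ ε := by
    rw [← le_div_iff₀ (by linarith)]
    exact min_le_right _ _
  have h4 : δ * (v + 1) * Real.log (w n) ≤ ε * Real.log (w n) :=
    mul_le_mul_of_nonneg_right hδ2 h3
  have h5 : δ * Real.log (w n) ≤ Real.log (w n) := mul_le_of_le_one_left h3 hδ1
  have h7 := (abs_le.1 h2).2
  have h8 : δ * Real.log (z n) ≤ δ * (2 * Real.log (w n)) :=
    mul_le_mul_of_nonneg_left (by linarith) hδ.le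
  have h9 : (v - 1) * |Real.log (z n) - Real.log (w n)| ≤ (v - 1) * (δ * Real.log (w n)) :=
    mul_le_mul_of_nonneg_left h2 (by linarith)
  have h10 : |(v - 1) * (Real.log (z n) - Real.log (w n))| =
      (v - 1) * |Real.log (z n) - Real.log (w n)| := by
    rw [abs_mul, abs_of_pos (by linarith)]
  rw [← h10] at h9
  have h11 := abs_le.1 h9
  have h12 := abs_le.1 h1
  rw [abs_le]
  constructor <;> linarith

/-- The exponent varies by `o(log w)` in a shell around `w` whose width is `o(log z / ψ' z)`. -/
lemma eventually_forall_abs_sub_le_mul_log {s : ℕ → ℝ} (hs0 : ∀ᶠ n in atTop, 0 ≤ s n)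
    (hs1 : ∀ᶠ n in atTop, s n ≤ 1)
    (hs : (fun n => s n * deriv ψ (z n)) =o[atTop] fun n => Real.log (z n)) {ε : ℝ} (hε : 0 < ε) :
    ∀ᶠ n in atTop, ∀ u, |u - w n| ≤ s n → |ψ u - ψ (w n)| ≤ ε * Real.log (w n) := by
  have heq : ∀ᶠ n in atTop, ψ (w n) + b * Real.log (w n) = ψ (z n) := by
    filter_upwards [hwn, hzn] with n h1 h2 using h1.trans h2.symm
  have hwz := (h.exists_abs_sub_le hm hv hRV b hw hz heq).1
  obtain ⟨M, ⟨hM1, hM2⟩, hM3⟩ := ((h.eventually_forall_sub_le hm hv hRV).and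
    (h.eventually_forall_deriv_pos hm hv hRV)).and (h.eventually_deriv_mono hm hv hRV) |>.exists
  set D : ℝ := (2 ^ v + 1) ^ 2 with hD
  have hD0 : 0 < D := by positivity
  have e1 := h.eventually_deriv_two_mul_le hm hv hRV
  have e2 := hz.eventually e1
  have e3 := (hz.const_mul_atTop (show (0 : ℝ) < 2 by norm_num)).eventually e1
  filter_upwards [hwz, e2, e3, hs0, hs1, hs.bound (show 0 < ε / (2 * D ^ 2) by positivity),
    eventually_abs_log_sub_log_le hw hz hwz one_pos, hw.eventually_ge_atTop (M + 1),
    hz.eventually_ge_atTop M, hw.eventually_ge_atTop 1, hz.eventually_ge_atTop 1]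
    with n h1 h2 h3 h4 h5 h6 h7 h8 h9 h10 h11 u hu
  have hu' := abs_le.1 hu
  have hz4 : deriv ψ (2 * (2 * z n)) ≤ D ^ 2 * deriv ψ (z n) := by
    rw [sq, mul_assoc]
    exact h3.trans (mul_le_mul_of_nonneg_left h2 hD0.le)
  -- The shell lies below w + 1 ≤ 4z, so ψ'(4z) bounds all slopes; two doublings compare it with
  -- ψ'(z).
  have key : |ψ u - ψ (w n)| ≤ deriv ψ (2 * (2 * z n)) * s n := by
    rcases le_total u (w n) with h12 | h12
    · have h13 := hM1 u (w n) (by linarith) h12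
      have h14 := hM3 (w n) (2 * (2 * z n)) (by linarith) (by linarith)
      have h15 := (hM2 (w n) (by linarith)).1
      have h16 := mul_nonneg (hM2 u (by linarith)).1.le (sub_nonneg.2 h12)
      rw [abs_of_nonpos (by linarith)]
      have h17 : deriv ψ (w n) * (w n - u) ≤ deriv ψ (2 * (2 * z n)) * s n :=
        mul_le_mul h14 (by linarith) (by linarith) (h15.le.trans h14)
      linarith
    · have h13 := hM1 (w n) u (by linarith) h12
      have h14 := hM3 u (2 * (2 * z n)) (by linarith) (by linarith)
      have h15 := (hM2 u (by linarith)).1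
      have h16 := mul_nonneg (hM2 (w n) (by linarith)).1.le (sub_nonneg.2 h12)
      rw [abs_of_nonneg (by linarith)]
      have h17 : deriv ψ u * (u - w n) ≤ deriv ψ (2 * (2 * z n)) * s n :=
        mul_le_mul h14 (by linarith) (by linarith) (h15.le.trans h14)
      linarith
  rw [Real.norm_eq_abs, Real.norm_eq_abs, abs_of_nonneg (Real.log_nonneg h11)] at h6
  have h18 := (le_abs_self _).trans h6
  have h19 : deriv ψ (2 * (2 * z n)) * s n ≤ D ^ 2 * deriv ψ (z n) * s n :=
    mul_le_mul_of_nonneg_right hz4 h4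
  have h20 := mul_le_mul_of_nonneg_left h18 (show 0 ≤ D ^ 2 by positivity)
  have h21 : D ^ 2 * (ε / (2 * D ^ 2) * Real.log (z n)) = ε / 2 * Real.log (z n) := by
    field_simp
  have h22 : Real.log (z n) ≤ 2 * Real.log (w n) := by linarith [(abs_le.1 h7).2]
  calc _ ≤ _ := key
    _ ≤ _ := h19
    _ = D ^ 2 * (s n * deriv ψ (z n)) := by ring
    _ ≤ ε / 2 * Real.log (z n) := by rw [← h21]; exact h20
    _ ≤ ε / 2 * (2 * Real.log (w n)) := by gcongr
    _ = _ := by ring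

/-- In log n + log q the terms ψ(w) and −ψ(|x|) cancel up to o(log w), leaving b log w from the
equation for w and α log |x| from L. Thus b tunes the intensity. -/
lemma eventually_forall_abs_log_mul_density_le {d : ℕ} (hd : 2 ≤ d)
    {q : EuclideanSpace ℝ (Fin d) → ℝ} (hq : IsRadialDensity q) {L : ℝ → ℝ} {α : ℝ}
    (hL : RegularlyVarying L α)
    (hqL : ∀ x, q x = L ‖x‖ * Real.exp (-ψ ‖x‖)) {s : ℕ → ℝ} (hs0 : ∀ᶠ n in atTop, 0 ≤ s n)
    (hs1 : ∀ᶠ n in atTop, s n ≤ 1)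
    (hs : (fun n => s n * deriv ψ (z n)) =o[atTop] fun n => Real.log (z n)) {ε : ℝ} (hε : 0 < ε) :
    ∀ᶠ n : ℕ in atTop, ∀ x, |‖x‖ - w n| ≤ s n →
      |Real.log (n * q x) - (α + b) * Real.log (w n)| ≤ ε * Real.log (w n) := by
  have e1 := eventually_forall_abs_sub_le_mul_log h hm hv hRV hw hz hwn hzn hs0 hs1 hs
    (show 0 < ε / 3 by positivity)
  obtain ⟨M, hM⟩ := eventually_atTop.1 (hq.eventually_abs_log_add_sub_le hd h hL hqL
    (show 0 < ε / 6 by positivity))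
  filter_upwards [e1, hs1, hwn, hw.eventually_ge_atTop (M + 1), hw.eventually_ge_atTop 2,
    (Real.tendsto_log_atTop.comp hw).eventually_ge_atTop (|α| * Real.log 2 / (ε / 3)),
    eventually_gt_atTop 0] with n h1 h2 h3 h4 h5 h6 hn x hx
  simp only [Function.comp] at h6
  rw [div_le_iff₀ (by positivity)] at h6
  have hx' := abs_le.1 hx
  have hx0 : 0 < ‖x‖ := by linarith
  have h7 := abs_le.1 (h1 ‖x‖ hx)
  have h8 := abs_le.1 (hM ‖x‖ (by linarith) x rfl)
  have h9 : Real.log ‖x‖ ≤ Real.log 2 + Real.log (w n) := by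
    rw [← Real.log_mul (by norm_num) (by linarith)]
    exact Real.log_le_log hx0 (by linarith)
  have h10 : Real.log (w n) ≤ Real.log 2 + Real.log ‖x‖ := by
    rw [← Real.log_mul (by norm_num) hx0.ne']
    exact Real.log_le_log (by linarith) (by linarith)
  have h11 : Real.log 2 ≤ Real.log (w n) := Real.log_le_log (by norm_num) h5
  have h12 : ε / 6 * Real.log ‖x‖ ≤ ε / 6 * (2 * Real.log (w n)) :=
    mul_le_mul_of_nonneg_left (by linarith) (by positivity)
  have h13 : |α * (Real.log ‖x‖ - Real.log (w n))| ≤ |α| * Real.log 2 := by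
    rw [abs_mul]
    exact mul_le_mul_of_nonneg_left (abs_le.2 ⟨by linarith, by linarith⟩) (abs_nonneg α)
  have h14 := abs_le.1 h13
  rw [Real.log_mul (by exact_mod_cast hn.ne') (hq.pos x).ne', ← h3, abs_le]
  constructor <;> linarith

end

/-- The logarithm of a radius between `1 / ψ' z` and `o(log z) / ψ' z`. -/
lemma eventually_abs_log_radius_add_le {ψ : ℝ → ℝ} {v : ℝ} (h : IsVonMises ψ)
    (hm : EventuallyMonotone (deriv ψ)) (hv : 1 < v) (hRV : RegularlyVarying ψ v) {b : ℝ}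
    {w z : ℕ → ℝ} (hw : Tendsto w atTop atTop) (hz : Tendsto z atTop atTop)
    (hwn : ∀ᶠ n : ℕ in atTop, ψ (w n) + b * Real.log (w n) = Real.log n)
    (hzn : ∀ᶠ n : ℕ in atTop, ψ (z n) = Real.log n) {ρ : ℕ → ℝ} (hρ0 : ∀ n, 0 < ρ n)
    (hρ1 : ∀ᶠ n in atTop, 1 ≤ ρ n * deriv ψ (z n))
    (hρ : (fun n => ρ n * deriv ψ (z n)) =o[atTop] fun n => Real.log (z n))
    {ε : ℝ} (hε : 0 < ε) :
    ∀ᶠ n in atTop, |Real.log (ρ n) + (v - 1) * Real.log (w n)| ≤ ε * Real.log (w n) := by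
  have heq : ∀ᶠ n in atTop, ψ (w n) + b * Real.log (w n) = ψ (z n) := by
    filter_upwards [hwn, hzn] with n h1 h2 using h1.trans h2.symm
  have hwz := (h.exists_abs_sub_le hm hv hRV b hw hz heq).1
  have hlz : Tendsto (fun n => Real.log (z n)) atTop atTop := Real.tendsto_log_atTop.comp hz
  filter_upwards [eventually_abs_log_deriv_sub_le h hm hv hRV hw hz hwn hzn (half_pos hε), hρ1,
    hρ.bound one_pos, hlz.eventually (Real.isLittleO_log_id_atTop.bound
      (show 0 < ε / 4 by positivity)), eventually_abs_log_sub_log_le hw hz hwz one_pos,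
    hz.eventually h.deriv_pos, hlz.eventually_gt_atTop 0,
    (Real.tendsto_log_atTop.comp hw).eventually_ge_atTop 0]
    with n h1 h2 h3 h4 h5 h6 h7 h8
  simp only [Function.comp, id, Real.norm_eq_abs] at h3 h4 h8
  rw [abs_of_pos h7] at h3 h4
  have h9 := abs_le.1 h1
  have h10 := (abs_le.1 h5).2
  have h11 := Real.log_nonneg h2
  have h12 := Real.log_le_log (mul_pos (hρ0 n) h6) ((le_abs_self _).trans h3)
  rw [Real.log_mul (hρ0 n).ne' h6.ne'] at h11 h12
  rw [one_mul] at h12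
  have h13 := (abs_le.1 h4).2
  have h14 : ε / 4 * Real.log (z n) ≤ ε / 4 * (2 * Real.log (w n)) := by gcongr; linarith
  have h15 : 0 ≤ ε * Real.log (w n) := by positivity
  rw [abs_le]
  constructor <;> linarith

/-- If `r ψ' z = o(log log n)`, then the geometric graph of the Poisson sample is disconnected with
high probability. -/
lemma withHighProbability_disconnected {d : ℕ} (hd : 2 ≤ d)
    {q : EuclideanSpace ℝ (Fin d) → ℝ} (hq : IsRadialDensity q)
    {ψ : ℝ → ℝ} (hψ : HasSuperexponentialDecay q ψ) {z : ℕ → ℝ} (hz : Tendsto z atTop atTop)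
    (hzn : ∀ᶠ n : ℕ in atTop, ψ (z n) = Real.log n) {r : ℕ → ℝ} (hr0 : ∀ n, 0 < r n)
    (hr : (fun n : ℕ => r n * deriv ψ (z n)) =o[atTop] fun n : ℕ => Real.log (Real.log n))
    {Ω : Type*} [MeasurableSpace Ω] {μ : Measure Ω} [IsProbabilityMeasure μ]
    {N : ℕ → Ω → ℕ} {X : ℕ → ℕ → Ω → EuclideanSpace ℝ (Fin d)}
    (hP : ∀ n, IsPoissonSample μ (densityMeasure q) n (N n) (X n)) :
    WithHighProbability μ fun n ω =>
      Disconnected (geometricGraph (points (N n) (X n) ω) (r n)) := by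
  obtain ⟨⟨h, hm, L, α, hL, hqL⟩, v, hv, hRV⟩ := hψ
  -- This b makes the intensity w^((v−1)d − 1/2 + o(1)). A ball of radius of order w^(−(v−1)+o(1))
  -- then has mean w^(−1/2+o(1)), which vanishes, while the w^(v+o(1)) balls together have mean
  -- w^(v−1/2+o(1)).
  obtain ⟨w, hw, hwn, -⟩ := h.exists_seq hm hv hRV ((v - 1) * d - 1 / 2 - α)
  have hlw : Tendsto (fun n => Real.log (w n)) atTop atTop := Real.tendsto_log_atTop.comp hw
  have hlz : Tendsto (fun n => Real.log (z n)) atTop atTop := Real.tendsto_log_atTop.comp hz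
  have hP0 := hz.eventually h.deriv_pos
  -- Since r may be far smaller than 1/ψ'(z), it is enlarged to a radius of known exponent; clusters
  -- isolated at scale ρ ≥ r are isolated at scale r.
  set ρ : ℕ → ℝ := fun n => max (r n) (1 / deriv ψ (z n)) with hρdef
  have hρ0 : ∀ n, 0 < ρ n := fun n => (hr0 n).trans_le (le_max_left _ _)
  have hρ1 : ∀ᶠ n in atTop, 1 ≤ ρ n * deriv ψ (z n) := by
    filter_upwards [hP0] with n hn
    rw [← div_le_iff₀ hn]
    exact le_max_right _ _
  have hρ : (fun n => ρ n * deriv ψ (z n)) =o[atTop] fun n => Real.log (z n) := by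
    have h1 := hr.trans_isTheta (isTheta_log_log h hv hRV hz hzn)
    have h2 : (fun _ : ℕ => (1 : ℝ)) =o[atTop] fun n => Real.log (z n) :=
      isLittleO_const_left.2 (Or.inr (tendsto_norm_atTop_atTop.comp hlz))
    refine IsBigO.trans_isLittleO (IsBigO.of_bound 1 ?_) (h1.norm_left.add h2)
    filter_upwards [hP0] with n hn
    rw [one_mul, Real.norm_eq_abs, Real.norm_eq_abs, Real.norm_eq_abs,
      abs_of_pos (mul_pos (hρ0 n) hn), abs_of_pos (mul_pos (hr0 n) hn), hρdef,
      max_mul_of_nonneg _ _ hn.le, one_div_mul_cancel hn.ne']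
    have := mul_pos (hr0 n) hn
    exact (max_le (by linarith) (by linarith)).trans (le_abs_self _)
  have hρt : Tendsto ρ atTop (𝓝 0) := by
    have h1 : Tendsto (fun n => Real.exp (-((v - 1) / 2 * Real.log (w n)))) atTop (𝓝 0) :=
      Real.tendsto_exp_neg_atTop_nhds_zero.comp (hlw.const_mul_atTop (by linarith))
    refine tendsto_of_tendsto_of_tendsto_of_le_of_le' tendsto_const_nhds h1
      (Eventually.of_forall fun n => (hρ0 n).le) ?_
    filter_upwards [eventually_abs_log_radius_add_le h hm hv hRV hw hz hwn hzn hρ0 hρ1 hρ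
      (show 0 < (v - 1) / 2 by linarith)] with n hn
    rw [← Real.log_le_iff_le_exp (hρ0 n)]
    linarith [(abs_le.1 hn).2]
  -- At most d factors ρ and one factor of density each cost ε in the exponent; the total 1/4 is
  -- half of the margin 1/2.
  set ε : ℝ := 1 / (4 * (d + 1)) with hεdef
  have hε : 0 < ε := by positivity
  have hεd : (d + 1) * ε = 1 / 4 := by
    rw [hεdef]
    field_simp
  have e1 := eventually_abs_log_radius_add_le h hm hv hRV hw hz hwn hzn hρ0 hρ1 hρ hε
  have e2 := eventually_forall_abs_log_mul_density_le h hm hv hRV hw hz hwn hzn hd hq hL hqL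
    (s := fun n => 2 * ρ n) (Eventually.of_forall fun n => by have := hρ0 n; positivity)
    (by filter_upwards [hρt.eventually (gt_mem_nhds (show (0 : ℝ) < 1 / 2 by norm_num))] with n hn
        linarith)
    (by simpa only [mul_assoc] using hρ.const_mul_left 2) hε
  set V := volume.real (Metric.ball (0 : EuclideanSpace ℝ (Fin d)) 1) with hV
  have hV0 : 0 < V := ENNReal.toReal_pos (Metric.measure_ball_pos _ _ one_pos).ne'
    measure_ball_lt_top.ne
  have hexp : Tendsto (fun n => Real.exp (Real.log (w n) / 4)) atTop atTop :=
    Real.tendsto_exp_atTop.comp (hlw.atTop_div_const (by norm_num))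
  have hbound : ∀ᶠ n in atTop,
      μ {ω | ¬ Disconnected (geometricGraph (points (N n) (X n) ω) (r n))} ≤
        ENNReal.ofReal (4 / (V / 48 * Real.exp (Real.log (w n) / 4))) := by
    filter_upwards [e1, e2, hexp.eventually_ge_atTop (2 ^ d * V),
      (hexp.const_mul_atTop (show 0 < V / 48 by positivity)).eventually_ge_atTop 2,
      hw.eventually_ge_atTop 2, hρt.eventually (gt_mem_nhds (show (0 : ℝ) < 1 / 2 by norm_num)),
      eventually_gt_atTop 0, hlw.eventually_ge_atTop 0] with n h1 h2 h3 h4 h5 h6 hn h7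
    set l := Real.log (w n) with hl
    set a := (v - 1) * d - 1 / 2 with ha
    have h1' := abs_le.1 h1
    have hexpρ : ρ n = Real.exp (Real.log (ρ n)) := (Real.exp_log (hρ0 n)).symm
    have hexpw : w n = Real.exp l := (Real.exp_log (by linarith)).symm
    have hd2 : (2 : ℝ) ≤ d := by exact_mod_cast hd
    have hεl : (d + 1) * (ε * l) = l / 4 := by rw [← mul_assoc, hεd]; ring
    have hlow : V / 48 * Real.exp (l / 4) ≤
        w n / (8 * ρ n) * (Real.exp ((a - ε) * l) * (ρ n ^ d * V) / 6) := by
      have h8 : w n / (8 * ρ n) * (Real.exp ((a - ε) * l) * (ρ n ^ d * V) / 6) =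
          V / 48 * (w n / ρ n * Real.exp ((a - ε) * l) * ρ n ^ d) := by
        have := (hρ0 n).ne'
        field_simp
        norm_num
      have h9 : w n / ρ n * Real.exp ((a - ε) * l) * ρ n ^ d =
          Real.exp (l - Real.log (ρ n) + (a - ε) * l + d * Real.log (ρ n)) := by
        rw [Real.exp_add, Real.exp_add, Real.exp_sub, ← hexpw, ← hexpρ, Real.exp_nat_mul, ← hexpρ]
      rw [h8, h9]
      refine mul_le_mul_of_nonneg_left (Real.exp_le_exp.2 ?_) (by positivity)
      have h10 : (d - 1) * (-((v - 1) * l) - ε * l) ≤ (d - 1) * Real.log (ρ n) :=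
        mul_le_mul_of_nonneg_left (by linarith) (by linarith)
      have h11 : 0 ≤ (v - 1) * l := mul_nonneg (by linarith) h7
      nlinarith
    have hup : Real.exp ((a + ε) * l) * ((2 * ρ n) ^ d * V) ≤ 1 := by
      have h8 : Real.exp ((a + ε) * l) * ρ n ^ d ≤ Real.exp (-(l / 4)) := by
        have h9 : ρ n ^ d = Real.exp (d * Real.log (ρ n)) := by
          rw [Real.exp_nat_mul, ← hexpρ]
        rw [h9, ← Real.exp_add]
        refine Real.exp_le_exp.2 ?_
        have h10 : d * Real.log (ρ n) ≤ d * (-((v - 1) * l) + ε * l) :=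
          mul_le_mul_of_nonneg_left (by linarith) (by linarith)
        nlinarith
      calc _ = Real.exp ((a + ε) * l) * ρ n ^ d * (2 ^ d * V) := by ring
        _ ≤ Real.exp (-(l / 4)) * Real.exp (l / 4) :=
          mul_le_mul h8 h3 (by positivity) (Real.exp_pos _).le
        _ = 1 := by rw [← Real.exp_add, neg_add_cancel, Real.exp_zero]
    refine ((hP n).measure_not_disconnected_le hd hq (le_max_left _ _) (hρ0 n) (R := w n)
      (by linarith) (Real.exp_pos ((a - ε) * l)) (Real.exp_pos ((a + ε) * l)) hV ?_ hup
      (h4.trans hlow)).trans (ENNReal.ofReal_le_ofReal ?_)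
    · intro x hx
      have h8 := abs_le.1 (h2 x hx)
      have h9 : 0 < n * q x := mul_pos (Nat.cast_pos.2 hn) (hq.pos x)
      rw [← Real.le_log_iff_exp_le h9, ← Real.log_le_iff_le_exp h9]
      have h10 : α + (a - α) = a := by ring
      rw [h10] at h8
      constructor <;> linarith
    · gcongr
  have hlim : Tendsto (fun n => ENNReal.ofReal (4 / (V / 48 * Real.exp (Real.log (w n) / 4))))
      atTop (𝓝 0) := by
    have h1 := (hexp.const_mul_atTop (show 0 < V / 48 by positivity)).const_div_atTop 4
    rw [← ENNReal.ofReal_zero]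
    exact (ENNReal.continuous_ofReal.tendsto 0).comp h1
  exact tendsto_of_tendsto_of_tendsto_of_le_of_le' tendsto_const_nhds hlim
    (Eventually.of_forall fun _ => zero_le) hbound

/-! ### The largest radius -/

/-- With high probability, a Poisson sample has no point outside a ball of radius `w` with
`ψ w - B log w = log n`, when `B` is large. -/
lemma withHighProbability_inter_compl_ball {d : ℕ} (hd : 2 ≤ d)
    {q : EuclideanSpace ℝ (Fin d) → ℝ} (hq : IsRadialDensity q) {ψ L : ℝ → ℝ} {v α : ℝ}
    (h : IsVonMises ψ) (hm : EventuallyMonotone (deriv ψ)) (hv : 1 < v)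
    (hRV : RegularlyVarying ψ v) (hL : RegularlyVarying L α)
    (hqL : ∀ x, q x = L ‖x‖ * Real.exp (-ψ ‖x‖)) {w : ℕ → ℝ} (hw : Tendsto w atTop atTop)
    (hwn : ∀ᶠ n : ℕ in atTop, ψ (w n) + -(|α + 1| + d + 1) * Real.log (w n) = Real.log n)
    {Ω : Type*} [MeasurableSpace Ω] {μ : Measure Ω} [IsProbabilityMeasure μ]
    {N : ℕ → Ω → ℕ} {X : ℕ → ℕ → Ω → EuclideanSpace ℝ (Fin d)}
    (hP : ∀ n, IsPoissonSample μ (densityMeasure q) n (N n) (X n)) :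
    WithHighProbability μ fun n ω =>
      points (N n) (X n) ω ∩ (Metric.ball 0 (w n))ᶜ = ∅ := by
  have := hq.isProbabilityMeasure
  obtain ⟨M₁, hM₁0, hmono, -⟩ := h.exists_strictMonoOn_add_log hm hv hRV (-(|α + 1| + d + 1))
  obtain ⟨M₂, hM₂⟩ := eventually_atTop.1 (hq.eventually_abs_log_add_sub_le hd h hL hqL one_pos)
  -- A fixed integrable function dominating n q outside the ball of radius w. The mean number of
  -- points there is at most the tail of a finite measure.
  set g : EuclideanSpace ℝ (Fin d) → ℝ := fun x => 2 ^ (d + 1) * (1 + ‖x‖) ^ (-((d : ℝ) + 1))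
    with hg
  have hgint : Integrable g volume :=
    (integrable_one_add_norm (by rw [finrank_euclideanSpace_fin]; linarith)).const_mul _
  set κ : Measure (EuclideanSpace ℝ (Fin d)) :=
    volume.withDensity fun x => ENNReal.ofReal (g x) with hκ
  have hκfin : IsFiniteMeasure κ := isFiniteMeasure_withDensity_ofReal hgint.2
  have hκlim : Tendsto (fun R : ℝ => κ (Metric.ball 0 R)ᶜ) atTop (𝓝 0) := by
    have h1 := tendsto_measure_iInter_atTop (μ := κ)
      (s := fun R : ℝ => (Metric.ball (0 : EuclideanSpace ℝ (Fin d)) R)ᶜ)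
      (fun R => measurableSet_ball.compl.nullMeasurableSet)
      (fun a b hab => Set.compl_subset_compl.2 (Metric.ball_subset_ball hab))
      ⟨0, measure_ne_top _ _⟩
    have h2 : (⋂ R : ℝ, (Metric.ball (0 : EuclideanSpace ℝ (Fin d)) R)ᶜ) = ∅ := by
      refine Set.eq_empty_of_forall_notMem fun x hx => ?_
      have h3 := Set.mem_iInter.1 hx (‖x‖ + 1)
      simp at h3
    rwa [h2, measure_empty] at h1
  refine tendsto_of_tendsto_of_tendsto_of_le_of_le' tendsto_const_nhds (hκlim.comp hw)
    (Eventually.of_forall fun _ => zero_le) ?_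
  filter_upwards [hwn, hw.eventually_ge_atTop (max (max M₁ M₂) 1), eventually_gt_atTop 0]
    with n h1 h2 hn
  have h3 : M₁ ≤ w n := (le_max_left _ _).trans ((le_max_left _ _).trans h2)
  have h4 : M₂ ≤ w n := (le_max_right _ _).trans ((le_max_left _ _).trans h2)
  have h5 : 1 ≤ w n := (le_max_right _ _).trans h2
  have hn' : (0 : ℝ) < n := Nat.cast_pos.2 hn
  have hpt : ∀ x ∈ (Metric.ball (0 : EuclideanSpace ℝ (Fin d)) (w n))ᶜ, n * q x ≤ g x := by
    intro x hx
    have hx1 : w n ≤ ‖x‖ := by simpa using hx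
    have hx0 : 0 < ‖x‖ := by linarith
    have hlx : 0 ≤ Real.log ‖x‖ := Real.log_nonneg (by linarith)
    -- For |x| ≥ w this gives log n ≤ ψ(|x|) − B log |x| with B = |α + 1| + d + 1, hence n q(x) ≤
    -- |x|^(α + 1 − B) ≤ |x|^(−(d+1)).
    have h6 := hmono.monotoneOn (show M₁ ≤ w n from h3) (show M₁ ≤ ‖x‖ by linarith) hx1
    rw [h1] at h6
    have h7 := (abs_le.1 (hM₂ ‖x‖ (by linarith) x rfl)).2
    have h8 : (α + 1) * Real.log ‖x‖ ≤ |α + 1| * Real.log ‖x‖ :=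
      mul_le_mul_of_nonneg_right (le_abs_self _) hlx
    have h9 : Real.log (n * q x) ≤ -((d : ℝ) + 1) * Real.log ‖x‖ := by
      rw [Real.log_mul hn'.ne' (hq.pos x).ne']
      linarith
    rw [Real.log_le_iff_le_exp (mul_pos hn' (hq.pos x)), mul_comm _ (Real.log ‖x‖),
      ← Real.rpow_def_of_pos hx0] at h9
    refine h9.trans ?_
    have h10 : (2 * ‖x‖) ^ (-((d : ℝ) + 1)) ≤ (1 + ‖x‖) ^ (-((d : ℝ) + 1)) :=
      Real.rpow_le_rpow_of_nonpos (by linarith) (by linarith) (by linarith)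
    rw [Real.mul_rpow (by norm_num) hx0.le, Real.rpow_neg (by norm_num)] at h10
    have h11 : (2 : ℝ) ^ ((d : ℝ) + 1) = 2 ^ (d + 1) := by
      rw [← Real.rpow_natCast]; push_cast; rfl
    rw [h11, inv_mul_le_iff₀ (by positivity)] at h10
    exact h10
  have hsub : {ω | ¬ points (N n) (X n) ω ∩ (Metric.ball 0 (w n))ᶜ = ∅} ⊆
      (emptyEvent (N n) (X n) (Metric.ball 0 (w n))ᶜ)ᶜ := by
    intro ω hω hω'
    refine hω (Set.eq_empty_of_forall_notMem ?_)
    rintro x ⟨⟨i, hi, rfl⟩, hx⟩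
    exact hω' i hi hx
  have hmeas : MeasurableSet (Metric.ball (0 : EuclideanSpace ℝ (Fin d)) (w n))ᶜ :=
    measurableSet_ball.compl
  refine (measure_mono hsub).trans (((hP n).measure_compl_emptyEvent_le hmeas).trans ?_)
  rw [ENNReal.ofReal_mul hn'.le, ofReal_measureReal]
  simp only [Function.comp]
  rw [hκ, densityMeasure, withDensity_apply _ hmeas, withDensity_apply _ hmeas,
    ← lintegral_const_mul _ hq.measurable.ennreal_ofReal]
  refine setLIntegral_mono' hmeas fun x hx => ?_
  rw [← ENNReal.ofReal_mul hn'.le]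
  exact ENNReal.ofReal_le_ofReal (hpt x hx)

/-! ### Cells -/

section Cells

variable {d : ℕ} {s R : ℝ}

lemma measurableSet_gridCube (j : Fin d → ℤ) : MeasurableSet (gridCube s j) := by
  have : gridCube s j = ⋂ k, {x | s * (j k : ℝ) - s / 2 ≤ x k} ∩
      {x | x k < s * (j k : ℝ) + s / 2} := by
    ext x
    simp [gridCube, forall_and]
  rw [this]
  refine MeasurableSet.iInter fun k => ?_
  have hk : Measurable fun x : EuclideanSpace ℝ (Fin d) => x k := by fun_prop
  exact (measurableSet_le measurable_const hk).inter (measurableSet_lt hk measurable_const)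

lemma measurableSet_cell (J : Set (Fin d → ℤ)) : MeasurableSet (cell s R J) :=
  MeasurableSet.biUnion J.to_countable fun j _ =>
    (measurableSet_gridCube j).inter measurableSet_ball

lemma ball_subset_gridCube (i : Fin d → ℤ) :
    Metric.ball (gridCentre s i) (s / 2) ⊆ gridCube s i := by
  intro x hx k
  have h1 := PiLp.norm_apply_le (x - gridCentre s i) k
  rw [PiLp.sub_apply, Real.norm_eq_abs] at h1
  have h2 := abs_lt.1 (h1.trans_lt (mem_ball_iff_norm.1 hx))
  simp only [gridCentre] at h2
  constructor <;> linarith [h2.1, h2.2]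

lemma gridCentre_mem_gridCube (hs : 0 < s) (i : Fin d → ℤ) : gridCentre s i ∈ gridCube s i :=
  ball_subset_gridCube i (Metric.mem_ball_self (half_pos hs))

lemma gridCentre_injective (hs : 0 < s) : Function.Injective (gridCentre (d := d) s) := by
  intro i j hij
  ext k
  have h1 : s * (i k : ℝ) = s * (j k : ℝ) := congrArg (fun x => x.ofLp k) hij
  exact_mod_cast mul_left_cancel₀ hs.ne' h1

/-- An inner cube is strictly nearest to itself, so it belongs to its own cell however ties are
broken. This bounds the mean of the cell from below. -/
lemma IsCellAssignment.gridCube_subset_cell (hs : 0 < s) {I : (Fin d → ℤ) → Set (Fin d → ℤ)}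
    (hI : IsCellAssignment s R I) {i : Fin d → ℤ} (hi : i ∈ innerIndices s R) :
    gridCube s i ⊆ cell s R (I i) := by
  have h1 : i ∈ I i := by
    refine (hI i hi).1 fun i' hi' => ?_
    rw [dist_self]
    exact dist_pos.2 fun h => hi'.2 (gridCentre_injective hs h)
  exact fun x hx => Set.mem_biUnion h1 ⟨hx, hi hx⟩

/-- Centres of inner cubes lie in the ball, so indices are bounded by R/s in each coordinate, and
2⌊R/s⌋ + 1 ≤ 3R/s because R/s ≥ 1. -/
lemma exists_finset_innerIndices (hs : 0 < s) (hsR : s ≤ R) :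
    ∃ T : Finset (Fin d → ℤ), (∀ i, i ∈ T ↔ i ∈ innerIndices s R) ∧ (T.card : ℝ) ≤ (3 * (R / s)) ^ d := by
  classical
  set m : ℤ := ⌊R / s⌋ with hm
  have hRs : 1 ≤ R / s := (one_le_div hs).2 hsR
  have hm0 : 0 ≤ m := Int.floor_nonneg.2 (by linarith)
  set U : Finset (Fin d → ℤ) := Fintype.piFinset fun _ => Finset.Icc (-m) m with hU
  have hsub : innerIndices (d := d) s R ⊆ U := by
    intro i hi
    rw [Finset.mem_coe, Fintype.mem_piFinset]
    intro k
    have h1 := mem_ball_zero_iff.1 (hi (gridCentre_mem_gridCube hs i))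
    have h2 := (PiLp.norm_apply_le (gridCentre s i) k).trans_lt h1
    simp only [gridCentre, Real.norm_eq_abs] at h2
    have h3 := abs_lt.1 h2
    rw [Finset.mem_Icc]
    have h4 : (i k : ℝ) ≤ R / s := by rw [le_div_iff₀ hs]; linarith [h3.2]
    have h5 : ((-i k : ℤ) : ℝ) ≤ R / s := by
      rw [le_div_iff₀ hs]; push_cast; linarith [h3.1]
    have h6 := Int.le_floor.2 h4
    have h7 := Int.le_floor.2 h5
    omega
  refine ⟨U.filter fun i => i ∈ innerIndices s R, fun i => ?_, ?_⟩
  · rw [Finset.mem_filter]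
    exact ⟨fun h => h.2, fun h => ⟨hsub h, h⟩⟩
  · have h1 : U.card = (2 * m + 1).toNat ^ d := by
      rw [hU, Fintype.card_piFinset_const, Int.card_Icc]
      congr 2
      ring
    have h2 : (((2 * m + 1).toNat : ℤ) : ℝ) ≤ 3 * (R / s) := by
      rw [Int.toNat_of_nonneg (by omega)]
      have := Int.floor_le (R / s)
      push_cast
      linarith
    calc (((U.filter fun i => i ∈ innerIndices s R).card : ℕ) : ℝ) ≤ U.card :=
          Nat.cast_le.2 (Finset.card_filter_le _ _)
      _ = ((2 * m + 1).toNat : ℝ) ^ d := by rw [h1]; push_cast; rfl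
      _ ≤ _ := by
          gcongr
          exact_mod_cast h2

/-- Uniform concentration of the counts of a Poisson sample over the cells. -/
lemma IsPoissonSample.measure_not_forall_cell_le {q : EuclideanSpace ℝ (Fin d) → ℝ}
    (hd : 2 ≤ d) (hq : IsRadialDensity q) {Ω : Type*} [MeasurableSpace Ω]
    {μ : Measure Ω} [IsProbabilityMeasure μ] {n : ℕ} {N : Ω → ℕ}
    {X : ℕ → Ω → EuclideanSpace ℝ (Fin d)} (hP : IsPoissonSample μ (densityMeasure q) n N X)
    {γ lo V : ℝ} (hs : 0 < s) (hsR : s ≤ R) (hγ : 0 < γ) (hγ1 : γ ≤ 1) (hlo : 0 < lo)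
    (hn : (0 : ℝ) < n)
    (hV : V = volume.real (Metric.ball (0 : EuclideanSpace ℝ (Fin d)) 1))
    (hq1 : ∀ x ∈ Metric.ball (0 : EuclideanSpace ℝ (Fin d)) R, lo ≤ n * q x)
    {I : (Fin d → ℤ) → Set (Fin d → ℤ)} (hI : IsCellAssignment s R I) :
    μ {ω | ¬ ∀ i ∈ innerIndices s R,
      (1 - γ) * (n * (densityMeasure q).real (cell s R (I i))) ≤
        ((points N X ω ∩ cell s R (I i)).ncard : ℝ) ∧
      ((points N X ω ∩ cell s R (I i)).ncard : ℝ) ≤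
        (1 + γ) * (n * (densityMeasure q).real (cell s R (I i)))} ≤
      ENNReal.ofReal ((3 * (R / s)) ^ d * (8 / (γ ^ 2 * (lo * ((s / 2) ^ d * V))))) := by
  classical
  have := hq.isProbabilityMeasure
  have : Nonempty (Fin d) := ⟨⟨0, by omega⟩⟩
  have : NullSingletonClass (densityMeasure q) := nullSingletonClass_withDensity _
  have hV0 : 0 < V := hV ▸ ENNReal.toReal_pos (Metric.measure_ball_pos _ _ one_pos).ne'
    measure_ball_lt_top.ne
  obtain ⟨T, hT, hTc⟩ := exists_finset_innerIndices (d := d) hs hsR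
  set A := fun i => cell s R (I i) with hA
  set bad : ℝ → (Fin d → ℤ) → Set Ω := fun t i =>
    {ω | t * ((1 + 2 * t) * (n * (densityMeasure q).real (A i))) ≤ t * pointCount N X (A i) ω}
    with hbad
  set x := γ ^ 2 * (lo * ((s / 2) ^ d * V)) with hx
  have hx0 : 0 < x := by positivity
  -- With t = ±γ/2 the Chernoff thresholds are 1 ± γ. The crude bound e^(−y) ≤ 1/y is enough, since
  -- the intensity can be made an arbitrarily high power of w.
  have hbadle : ∀ t, t ^ 2 = γ ^ 2 / 4 → |t| ≤ 1 → ∀ i ∈ T,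
      μ (bad t i) ≤ ENNReal.ofReal (4 / x) := by
    intro t ht ht1 i hi
    refine (hP.measure_pointCount_le (measurableSet_cell _) ht1).trans
      (ENNReal.ofReal_le_ofReal ?_)
    have h1 : lo * ((s / 2) ^ d * V) ≤ n * (densityMeasure q).real (A i) := by
      have h2 : Metric.ball (gridCentre s i) (s / 2) ⊆ Metric.ball 0 R :=
        (ball_subset_gridCube i).trans ((hT i).1 hi)
      have h3 := hq.mul_volume_le (S := Metric.ball (gridCentre s i) (s / 2)) measurableSet_ball
        (c := lo / n) (by positivity) fun y hy => by
          rw [div_le_iff₀ hn, mul_comm]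
          exact hq1 y (h2 hy)
      rw [volumeReal_ball _ (half_pos hs), ← hV] at h3
      have h4 := mul_le_mul_of_nonneg_left h3 hn.le
      rw [← mul_assoc, mul_div_cancel₀ _ hn.ne'] at h4
      refine h4.trans (mul_le_mul_of_nonneg_left (measureReal_mono ?_) hn.le)
      exact (ball_subset_gridCube i).trans (hI.gridCube_subset_cell hs ((hT i).1 hi))
    have h5 : x / 4 ≤ n * (densityMeasure q).real (A i) * t ^ 2 := by
      rw [ht, hx]
      nlinarith [sq_nonneg γ]
    calc _ ≤ Real.exp (-(x / 4)) := Real.exp_le_exp.2 (neg_le_neg h5)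
      _ ≤ (x / 4)⁻¹ := by
          rw [Real.exp_neg]
          exact inv_anti₀ (by positivity) (by linarith [Real.add_one_le_exp (x / 4)])
      _ = 4 / x := by rw [inv_div]
  have hsub : {ω | ¬ ∀ i ∈ innerIndices s R,
      (1 - γ) * (n * (densityMeasure q).real (A i)) ≤ ((points N X ω ∩ A i).ncard : ℝ) ∧
      ((points N X ω ∩ A i).ncard : ℝ) ≤ (1 + γ) * (n * (densityMeasure q).real (A i))} ⊆
      {ω | ¬ ∀ i j, X i ω = X j ω → i = j} ∪ ⋃ i ∈ T, (bad (γ / 2) i ∪ bad (-(γ / 2)) i) := by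
    intro ω hω
    by_cases hinj : ∀ i j, X i ω = X j ω → i = j
    · right
      by_contra hcon
      refine hω fun i hi => ?_
      simp only [Set.mem_iUnion, not_exists, Set.mem_union, not_or] at hcon
      obtain ⟨h1, h2⟩ := hcon i ((hT i).2 hi)
      simp only [hbad, Set.mem_ofPred_eq, not_le] at h1 h2
      rw [ncard_points_inter _ hinj]
      have h3 := lt_of_mul_lt_mul_left h1 (by positivity)
      have h4 : γ / 2 * ((1 - γ) * (n * (densityMeasure q).real (A i))) <
          γ / 2 * pointCount N X (A i) ω := by linarith
      have h5 := lt_of_mul_lt_mul_left h4 (by positivity)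
      exact ⟨h5.le, by linarith⟩
    · exact Or.inl hinj
  refine (measure_mono hsub).trans ((measure_union_le _ _).trans ?_)
  rw [ae_iff.1 hP.ae_injective, zero_add]
  refine (measure_biUnion_finset_le _ _).trans ?_
  have hγ2 : |γ / 2| ≤ 1 := by rw [abs_of_pos (by positivity)]; linarith
  calc ∑ i ∈ T, μ (bad (γ / 2) i ∪ bad (-(γ / 2)) i)
      ≤ ∑ i ∈ T, ENNReal.ofReal (8 / x) := by
        refine Finset.sum_le_sum fun i hi => (measure_union_le _ _).trans ?_
        refine (add_le_add (hbadle (γ / 2) (by ring) hγ2 i hi)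
          (hbadle (-(γ / 2)) (by ring) (by rwa [abs_neg]) i hi)).trans_eq ?_
        rw [← ENNReal.ofReal_add (by positivity) (by positivity)]
        congr 1
        ring
    _ = ENNReal.ofReal (T.card * (8 / x)) := by
        rw [Finset.sum_const, nsmul_eq_mul, ENNReal.ofReal_mul (by positivity),
          ENNReal.ofReal_natCast]
    _ ≤ _ := ENNReal.ofReal_le_ofReal (mul_le_mul_of_nonneg_right hTc (by positivity))

end Cells

/-- A lower bound for the intensity on a ball of radius `w` with `ψ w + B log w = log n`. -/
lemma eventually_exp_le_mul_density {d : ℕ} (hd : 2 ≤ d)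
    {q : EuclideanSpace ℝ (Fin d) → ℝ} (hq : IsRadialDensity q) {ψ L : ℝ → ℝ} {v α B : ℝ}
    (h : IsVonMises ψ) (hm : EventuallyMonotone (deriv ψ)) (hv : 1 < v)
    (hRV : RegularlyVarying ψ v) (hL : RegularlyVarying L α)
    (hqL : ∀ x, q x = L ‖x‖ * Real.exp (-ψ ‖x‖)) (hlb : LocallyBoundedBelow q)
    {w : ℕ → ℝ} (hw : Tendsto w atTop atTop)
    (hwn : ∀ᶠ n : ℕ in atTop, ψ (w n) + B * Real.log (w n) = Real.log n) :
    ∀ᶠ n : ℕ in atTop, ∀ x ∈ Metric.ball (0 : EuclideanSpace ℝ (Fin d)) (w n),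
      Real.exp ((B - |α - 1|) * Real.log (w n)) ≤ n * q x := by
  obtain ⟨M₁, hM₁⟩ := (h.eventually_forall_le hm hv hRV).exists
  obtain ⟨M₂, hM₂⟩ := eventually_atTop.1 (hq.eventually_abs_log_add_sub_le hd h hL hqL one_pos)
  set M := max (max M₁ M₂) 1 with hM
  obtain ⟨c, hc, hqc⟩ := hlb M
  filter_upwards [hwn, (h.tendsto_atTop.comp hw).eventually_ge_atTop (-Real.log c),
    hw.eventually_ge_atTop 1, eventually_gt_atTop 0] with n h1 h2 h3 hn x hx
  simp only [Function.comp] at h2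
  have hn' : (0 : ℝ) < n := Nat.cast_pos.2 hn
  have hlw : 0 ≤ Real.log (w n) := Real.log_nonneg h3
  have hαl : 0 ≤ |α - 1| * Real.log (w n) := mul_nonneg (abs_nonneg _) hlw
  have hxw : ‖x‖ < w n := mem_ball_zero_iff.1 hx
  rw [← Real.le_log_iff_exp_le (mul_pos hn' (hq.pos x)), Real.log_mul hn'.ne' (hq.pos x).ne', ← h1]
  suffices h4 : -ψ (w n) - |α - 1| * Real.log (w n) ≤ Real.log (q x) by linarith
  -- Near the origin q ≥ c ≥ e^(−ψ(w)) for large n; farther out ψ(|x|) ≤ ψ(w) and the power of |x|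
  -- costs at most w^|α − 1|.
  rcases le_total ‖x‖ M with hxM | hxM
  · have h5 := Real.log_le_log hc (hqc x hxM)
    linarith
  · have hx1 : M₁ ≤ ‖x‖ := (le_max_left _ _).trans ((le_max_left _ _).trans hxM)
    have hx2 : M₂ ≤ ‖x‖ := (le_max_right _ _).trans ((le_max_left _ _).trans hxM)
    have hx3 : 1 ≤ ‖x‖ := (le_max_right _ _).trans hxM
    have h5 := (abs_le.1 (hM₂ ‖x‖ hx2 x rfl)).1
    have h6 := hM₁ ‖x‖ (w n) hx1 hxw.le
    have h7 : -(|α - 1| * Real.log (w n)) ≤ (α - 1) * Real.log ‖x‖ := by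
      have h8 := mul_le_mul_of_nonneg_left (Real.log_le_log (by linarith) hxw.le)
        (abs_nonneg (α - 1))
      have h9 := mul_le_mul_of_nonneg_right (neg_abs_le (α - 1)) (Real.log_nonneg hx3)
      linarith
    linarith

/-- With high probability, the counts of the sample concentrate simultaneously in all cells of a
ball of radius `w` with `ψ w + B log w = log n`, when `B` is large. -/
lemma withHighProbability_cells {d : ℕ} (hd : 2 ≤ d)
    {q : EuclideanSpace ℝ (Fin d) → ℝ} (hq : IsRadialDensity q) {ψ L : ℝ → ℝ} {v α B : ℝ}
    (h : IsVonMises ψ) (hm : EventuallyMonotone (deriv ψ)) (hv : 1 < v)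
    (hRV : RegularlyVarying ψ v) (hL : RegularlyVarying L α)
    (hqL : ∀ x, q x = L ‖x‖ * Real.exp (-ψ ‖x‖)) (hlb : LocallyBoundedBelow q)
    (hB : B = |α - 1| + (1 + 4 * v) * d + 2 * v + 1)
    {w z : ℕ → ℝ} (hw : Tendsto w atTop atTop)
    (hwn : ∀ᶠ n : ℕ in atTop, ψ (w n) + B * Real.log (w n) = Real.log n)
    (hz : Tendsto z atTop atTop) (hzn : ∀ᶠ n : ℕ in atTop, ψ (z n) = Real.log n)
    {r : ℕ → ℝ} (hr0 : ∀ n, 0 < r n) (hr1 : ∀ n, r n ≤ 1)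
    (hrP : ∀ᶠ n in atTop, 1 ≤ r n * deriv ψ (z n))
    {γ : ℕ → ℝ} (hγ0 : ∀ n, 0 < γ n) (hγ1 : ∀ᶠ n in atTop, γ n ≤ 1)
    (hγP : ∀ᶠ n in atTop, 1 ≤ γ n * deriv ψ (z n))
    {Ω : Type*} [MeasurableSpace Ω] {μ : Measure Ω} [IsProbabilityMeasure μ]
    {N : ℕ → Ω → ℕ} {X : ℕ → ℕ → Ω → EuclideanSpace ℝ (Fin d)}
    (hP : ∀ n, IsPoissonSample μ (densityMeasure q) n (N n) (X n))
    {I : ℕ → (Fin d → ℤ) → Set (Fin d → ℤ)}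
    (hI : ∀ n, IsCellAssignment (γ n * r n) (w n) (I n)) :
    WithHighProbability μ fun n ω => ∀ i ∈ innerIndices (γ n * r n) (w n),
      (1 - γ n) * (n * (densityMeasure q).real (cell (γ n * r n) (w n) (I n i))) ≤
        ((points (N n) (X n) ω ∩ cell (γ n * r n) (w n) (I n i)).ncard : ℝ) ∧
      ((points (N n) (X n) ω ∩ cell (γ n * r n) (w n) (I n i)).ncard : ℝ) ≤
        (1 + γ n) * (n * (densityMeasure q).real (cell (γ n * r n) (w n) (I n i))) := by
  have hlw : Tendsto (fun n => Real.log (w n)) atTop atTop := Real.tendsto_log_atTop.comp hw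
  set V := volume.real (Metric.ball (0 : EuclideanSpace ℝ (Fin d)) 1) with hV
  have hV0 : 0 < V := ENNReal.toReal_pos (Metric.measure_ball_pos _ _ one_pos).ne'
    measure_ball_lt_top.ne
  have hlim : Tendsto (fun n => ENNReal.ofReal (3 ^ d * 8 * 2 ^ d / V * Real.exp (-Real.log (w n))))
      atTop (𝓝 0) := by
    have h1 := (Real.tendsto_exp_neg_atTop_nhds_zero.comp hlw).const_mul (3 ^ d * 8 * 2 ^ d / V)
    rw [mul_zero] at h1
    rw [← ENNReal.ofReal_zero]
    exact (ENNReal.continuous_ofReal.tendsto 0).comp h1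
  refine tendsto_of_tendsto_of_tendsto_of_le_of_le' tendsto_const_nhds hlim
    (Eventually.of_forall fun _ => zero_le) ?_
  filter_upwards [eventually_exp_le_mul_density hd hq h hm hv hRV hL hqL hlb hw hwn, hrP, hγ1, hγP,
    eventually_abs_log_deriv_sub_le h hm hv hRV hw hz hwn hzn one_pos, hz.eventually h.deriv_pos,
    hw.eventually_ge_atTop 1, eventually_gt_atTop 0] with n h1 h2 h3 h4 h5 h6 h7 hn
  set l := Real.log (w n) with hl
  have hl0 : 0 ≤ l := Real.log_nonneg h7
  have hexpw : w n = Real.exp l := (Real.exp_log (by linarith)).symm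
  set G := Real.log (γ n) with hG
  set S := Real.log (r n) with hS
  have hexpG : γ n = Real.exp G := (Real.exp_log (hγ0 n)).symm
  have hexpS : r n = Real.exp S := (Real.exp_log (hr0 n)).symm
  have h8 : Real.log (deriv ψ (z n)) ≤ v * l := by linarith [(abs_le.1 h5).2]
  have hGl : -(v * l) ≤ G := by
    have := Real.log_nonneg h4
    rw [Real.log_mul (hγ0 n).ne' h6.ne'] at this
    linarith
  have hSl : -(v * l) ≤ S := by
    have := Real.log_nonneg h2
    rw [Real.log_mul (hr0 n).ne' h6.ne'] at this
    linarith
  have hs0 : 0 < γ n * r n := mul_pos (hγ0 n) (hr0 n)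
  have hsw : γ n * r n ≤ w n := by
    have := mul_le_one₀ h3 (hr0 n).le (hr1 n)
    linarith
  refine ((hP n).measure_not_forall_cell_le hd hq hs0 hsw (hγ0 n) h3
    (Real.exp_pos ((B - |α - 1|) * l)) (Nat.cast_pos.2 hn) hV h1 (hI n)).trans
    (ENNReal.ofReal_le_ofReal ?_)
  have h9 : (3 * (w n / (γ n * r n))) ^ d * (8 / (γ n ^ 2 *
      (Real.exp ((B - |α - 1|) * l) * ((γ n * r n / 2) ^ d * V)))) =
      3 ^ d * 8 * 2 ^ d / V * (w n ^ d / ((γ n * r n) ^ d * (γ n * r n) ^ d * γ n ^ 2 *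
        Real.exp ((B - |α - 1|) * l))) := by
    have h10 := (hγ0 n).ne'
    have h11 := (hr0 n).ne'
    rw [mul_pow 3, div_pow, div_pow]
    field_simp
  have h10 : w n ^ d / ((γ n * r n) ^ d * (γ n * r n) ^ d * γ n ^ 2 *
      Real.exp ((B - |α - 1|) * l)) =
      Real.exp (d * l - (d * (G + S) + d * (G + S) + 2 * G + (B - |α - 1|) * l)) := by
    have h11 : γ n ^ 2 = Real.exp (2 * G) := by
      rw [hexpG, ← Real.exp_nat_mul]; norm_num
    have h12 : (γ n * r n) ^ d = Real.exp (d * (G + S)) := by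
      rw [hexpG, hexpS, ← Real.exp_add, ← Real.exp_nat_mul]
    rw [Real.exp_sub, Real.exp_add, Real.exp_add, Real.exp_add, h11, h12, Real.exp_nat_mul l d,
      ← hexpw]
  rw [h9, h10]
  refine mul_le_mul_of_nonneg_left (Real.exp_le_exp.2 ?_) (by positivity)
  -- Since γ and r are at least w^(−v), there are O(w^((1+2v)d)) cells, each failing with
  -- probability O(w^(2vd + 2v − (B − |α−1|))). The chosen B makes the total O(1/w).
  have h11 : (d : ℝ) * (-(2 * (v * l))) ≤ d * (G + S) :=
    mul_le_mul_of_nonneg_left (by linarith) d.cast_nonneg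
  rw [hB]
  linarith

/-! ### The two sequences of radii -/

/-- The equations `ψ z ± b log z = log n` have solutions that form strictly increasing sequences. -/
lemma IsVonMises.exists_strictMono_seq {ψ : ℝ → ℝ} {v : ℝ} (h : IsVonMises ψ)
    (hm : EventuallyMonotone (deriv ψ)) (hv : 1 < v) (hRV : RegularlyVarying ψ v) {b c : ℝ}
    (hb : 0 ≤ b) (hc : 0 ≤ c) :
    ∃ u w : ℕ → ℝ, StrictMono u ∧ StrictMono w ∧ (∀ n, 0 < u n) ∧ (∀ n, u n ≤ w n) ∧
      Tendsto u atTop atTop ∧ Tendsto w atTop atTop ∧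
      (∀ᶠ n : ℕ in atTop, ψ (u n) + b * Real.log (u n) = Real.log n) ∧
      ∀ᶠ n : ℕ in atTop, ψ (w n) + -c * Real.log (w n) = Real.log n := by
  obtain ⟨u, hu, hun, humono⟩ := h.exists_seq hm hv hRV b
  obtain ⟨w, hw, hwn, hwmono⟩ := h.exists_seq hm hv hRV (-c)
  obtain ⟨M, -, hM, -⟩ := h.exists_strictMonoOn_add_log hm hv hRV b
  -- At w the increasing function ψ + b log is at least ψ − c log, which equals log n, its value at
  -- u.
  have huw : ∀ᶠ n in atTop, u n ≤ w n := by
    filter_upwards [hun, hwn, hu.eventually_ge_atTop M, hw.eventually_ge_atTop M,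
      hw.eventually_ge_atTop 1] with n h1 h2 h3 h4 h5
    by_contra! hlt
    have h6 := hM h4 h3 hlt
    simp only at h6
    have h7 := mul_nonneg hb (Real.log_nonneg h5)
    have h8 := mul_nonneg hc (Real.log_nonneg h5)
    linarith
  obtain ⟨n₀, ⟨⟨⟨hu0, hum⟩, hwm⟩, hle⟩⟩ := (((eventually_forall_ge_atTop.2 (hu.eventually_gt_atTop 0)).and
    humono).and hwmono).and (eventually_forall_ge_atTop.2 huw) |>.exists
  -- The finitely many terms before n₀ are replaced by a linear ramp up to a(n₀); the shift n + 1
  -- keeps the term at 0 positive.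
  set f : (ℕ → ℝ) → ℕ → ℝ := fun a n => if n < n₀ then a n₀ * ((n + 1) / (n₀ + 1)) else a n with hf
  have hfe : ∀ a, ∀ᶠ n in atTop, a n = f a n := fun a => by
    filter_upwards [eventually_ge_atTop n₀] with n hn
    rw [hf]
    simp only [if_neg (not_lt.2 hn)]
  have hfmono : ∀ a : ℕ → ℝ, 0 < a n₀ → (∀ m n, n₀ ≤ m → m < n → a m < a n) →
      StrictMono (f a) := by
    intro a ha0 ha
    refine strictMono_nat_of_lt_succ fun n => ?_
    simp only [hf]
    rcases lt_trichotomy (n + 1) n₀ with hlt | heq | hgt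
    · rw [if_pos (by omega), if_pos hlt]
      push_cast
      gcongr
      linarith
    · rw [if_pos (by omega), if_neg (by omega), heq]
      refine mul_lt_of_lt_one_right ha0 ((div_lt_one (by positivity)).2 ?_)
      have : (n : ℝ) + 1 = n₀ := by exact_mod_cast heq
      linarith
    · rw [if_neg (by omega), if_neg (by omega)]
      exact ha n (n + 1) (by omega) (by omega)
  refine ⟨f u, f w, hfmono u (hu0 n₀ le_rfl) hum,
    hfmono w ((hu0 n₀ le_rfl).trans_le (hle n₀ le_rfl)) hwm, fun n => ?_, fun n => ?_,
    hu.congr' (hfe u), hw.congr' (hfe w), ?_, ?_⟩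
  · simp only [hf]
    split_ifs with hn
    · have := hu0 n₀ le_rfl
      positivity
    · exact hu0 n (not_lt.1 hn)
  · simp only [hf]
    split_ifs with hn
    · have := hle n₀ le_rfl
      gcongr
    · exact hle n (not_lt.1 hn)
  · filter_upwards [hun, hfe u] with n h1 h2
    rw [← h2, h1]
  · filter_upwards [hwn, hfe w] with n h1 h2
    rw [← h2, h1]

end PoissonGraph

/-! ### The theorem -/

theorem mainTheorem1 {d : ℕ} (hd : 2 ≤ d)
    (q : EuclideanSpace ℝ (Fin d) → ℝ) (hq : PoissonGraph.IsRadialDensity q)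
    (ψ : ℝ → ℝ) (hψ : PoissonGraph.HasSuperexponentialDecay q ψ)
    (ψinv : ℝ → ℝ) (hψinv : PoissonGraph.IsAsymptoticInverse ψ ψinv)
    (r : ℕ → ℝ) (hr_pos : ∀ n, 0 < r n) (hr_le : ∀ n, r n ≤ 1) (hr_anti : Antitone r)
    {Ω : Type*} [MeasurableSpace Ω] (μ : Measure Ω) [IsProbabilityMeasure μ]
    (N : ℕ → Ω → ℕ) (X : ℕ → ℕ → Ω → EuclideanSpace ℝ (Fin d))
    (hP : ∀ n, PoissonGraph.IsPoissonSample μ (PoissonGraph.densityMeasure q) n (N n) (X n)) :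
    ((fun n : ℕ => r n * deriv ψ (ψinv (Real.log n)))
        =o[atTop] (fun n : ℕ => Real.log (Real.log n)) →
      PoissonGraph.WithHighProbability μ (fun n ω =>
        PoissonGraph.Disconnected
          (PoissonGraph.geometricGraph (PoissonGraph.points (N n) (X n) ω) (r n)))) ∧
    ((fun n : ℕ => Real.log (Real.log n))
        =o[atTop] (fun n : ℕ => r n * deriv ψ (ψinv (Real.log n))) →
      ∃ R₀ R₁ : ℕ → ℝ,
        StrictMono R₀ ∧ StrictMono R₁ ∧ (∀ n, 0 < R₀ n) ∧ (∀ n, R₀ n ≤ R₁ n) ∧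
        (fun n => R₁ n - R₀ n) =o[atTop] r ∧
        PoissonGraph.WithHighProbability μ (fun n ω =>
          PoissonGraph.points (N n) (X n) ω ∩ (Metric.ball 0 (R₁ n))ᶜ = ∅) ∧
        (PoissonGraph.LocallyBoundedBelow q →
          ∀ γ : ℕ → ℝ, (∀ n, 0 < γ n) → Tendsto γ atTop (𝓝 0) →
            (fun _ : ℕ => (1 : ℝ)) =o[atTop] (fun n : ℕ => γ n * deriv ψ (ψinv (Real.log n))) →
            ∀ I : ℕ → (Fin d → ℤ) → Set (Fin d → ℤ),
              (∀ n, PoissonGraph.IsCellAssignment (γ n * r n) (R₀ n) (I n)) →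
              PoissonGraph.WithHighProbability μ (fun n ω =>
                ∀ i ∈ PoissonGraph.innerIndices (γ n * r n) (R₀ n),
                  (1 - γ n) * (n * (PoissonGraph.densityMeasure q).real
                      (PoissonGraph.cell (γ n * r n) (R₀ n) (I n i))) ≤
                    ((PoissonGraph.points (N n) (X n) ω ∩
                      PoissonGraph.cell (γ n * r n) (R₀ n) (I n i)).ncard : ℝ) ∧
                  ((PoissonGraph.points (N n) (X n) ω ∩
                      PoissonGraph.cell (γ n * r n) (R₀ n) (I n i)).ncard : ℝ) ≤
                    (1 + γ n) * (n * (PoissonGraph.densityMeasure q).real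
                      (PoissonGraph.cell (γ n * r n) (R₀ n) (I n i)))))) := by
  obtain ⟨⟨h, hm, L, α, hL, hqL⟩, v, hv, hRV⟩ := id hψ
  obtain ⟨hz, hzn⟩ := PoissonGraph.tendsto_asymptoticInverse h hm hv hRV hψinv
  set z : ℕ → ℝ := fun n => ψinv (Real.log n) with hzdef
  have hP0 := hz.eventually h.deriv_pos
  refine ⟨fun hr => PoissonGraph.withHighProbability_disconnected hd hq hψ hz hzn hr_pos hr hP,
    fun hr => ?_⟩
  obtain ⟨R₀, R₁, hmono₀, hmono₁, hpos, hle, hR₀, hR₁, hR₀n, hR₁n⟩ :=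
    h.exists_strictMono_seq hm hv hRV (b := |α - 1| + (1 + 4 * v) * d + 2 * v + 1)
      (c := |α + 1| + d + 1) (by positivity) (by positivity)
  have hlogr : (fun n => Real.log (z n)) =o[atTop] fun n => r n * deriv ψ (z n) :=
    (PoissonGraph.isTheta_log_log h hv hRV hz hzn).symm.trans_isLittleO hr
  refine ⟨R₀, R₁, hmono₀, hmono₁, hpos, hle, ?_,
    PoissonGraph.withHighProbability_inter_compl_ball hd hq h hm hv hRV hL hqL hR₁ hR₁n hP,
    fun hlb γ hγ0 hγt hγP I hI => ?_⟩
  -- Each radius is within O(log z / ψ'(z)) of z, which is o(r) because log z = o(r ψ'(z)).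
  · have hclose : ∀ {b : ℝ} {w : ℕ → ℝ}, Tendsto w atTop atTop →
        (∀ᶠ n : ℕ in atTop, ψ (w n) + b * Real.log (w n) = Real.log n) →
        (fun n => w n - z n) =o[atTop] r := by
      intro b w hw hwn
      obtain ⟨C, hC, hCn⟩ := (h.exists_abs_sub_le hm hv hRV b hw hz
        (by filter_upwards [hwn, hzn] with n h1 h2 using h1.trans h2.symm)).2
      refine IsBigO.trans_isLittleO (IsBigO.of_bound C ?_)
        (g := fun n => Real.log (z n) / deriv ψ (z n)) ?_
      · filter_upwards [hCn] with n hn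
        rw [Real.norm_eq_abs, Real.norm_eq_abs]
        exact hn.trans (mul_le_mul_of_nonneg_left (le_abs_self _) hC.le)
      · have h1 := hlogr.mul_isBigO (isBigO_refl (fun n => (deriv ψ (z n))⁻¹) atTop)
        refine h1.congr' (Eventually.of_forall fun n => (div_eq_mul_inv _ _).symm) ?_
        filter_upwards [hP0] with n hn
        rw [mul_assoc, mul_inv_cancel₀ hn.ne', mul_one]
    exact ((hclose hR₁ hR₁n).sub (hclose hR₀ hR₀n)).congr_left fun n => by ring
  · have hone : ∀ {a : ℕ → ℝ}, (∀ n, 0 < a n) →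
        (fun _ : ℕ => (1 : ℝ)) =o[atTop] (fun n => a n * deriv ψ (z n)) →
        ∀ᶠ n in atTop, 1 ≤ a n * deriv ψ (z n) := by
      intro a ha0 ha
      filter_upwards [ha.bound one_pos, hP0] with n hn hn0
      rwa [norm_one, one_mul, Real.norm_eq_abs, abs_of_pos (mul_pos (ha0 n) hn0)] at hn
    have h1log : (fun _ : ℕ => (1 : ℝ)) =o[atTop] fun n => Real.log (z n) :=
      isLittleO_const_left.2
        (Or.inr (tendsto_norm_atTop_atTop.comp (Real.tendsto_log_atTop.comp hz)))
    exact PoissonGraph.withHighProbability_cells hd hq h hm hv hRV hL hqL hlb rfl hR₀ hR₀n hz hzn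
      hr_pos hr_le (hone hr_pos (h1log.trans hlogr)) hγ0 (hγt.eventually_le_const one_pos)
      (hone hγ0 hγP) hP hI
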